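/- **Setting.** Let $\mathcal H$ be a smooth manifold of dimension $m\ge 1$. Metric hypersurface data is $\{\mathcal H,\gamma,\ell,\ell^{(2)}\}$ with $\gamma$ a symmetric two-covariant tensor, $\ell$ a one-form and $\ell^{(2)}$ a scalar (all smooth) such that $\mathcal A((W,a),(Z,b))=\gamma(W,Z)+a\,\ell(Z)+b\,\ell(W)+ab\,\ell^{(2)}$ is non-degenerate on each $T_p\mathcal H\times\mathbb R$; hypersurface data contains in addition a smooth symmetric two-covariant tensor $Y$. The inverse of $\mathcal A$ defines $P$, $n$, $n^{(2)}$ by $\mathcal A^\sharp((\alpha,a),(\beta,b))=P(\alpha,\beta)+a\,\beta(n)+b\,\alpha(n)+ab\,n^{(2)}$. Put $K=n^{(2)}Y+\frac12\mathcal L_n\gamma+\ell\otimes_s dn^{(2)}$, $F=\frac12 d\ell$, $\Pi=Y+F$, and let $\overline\nabla$ be the torsion-free connection with $\overline\nabla_a\gamma_{bc}=-\ell_bK_{ac}-\ell_cK_{ab}$ and $\overline\nabla_a\ell_b=\Pi_{ab}-\ell^{(2)}K_{ab}$, with curvature $\overline R(X,W)Z=\overline\nabla_X\overline\nabla_WZ-\overline\nabla_W\overline\nabla_XZ-\overline\nabla_{[X,W]}Z$,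 $\overline R(\partial_c,\partial_d)\partial_b=\overline R^a{}_{bcd}\partial_a$. The constraint tensors are $$\mathcal R_{ab}=B_{acbd}P^{cd}-(A_{bac}+A_{abc})n^c,\qquad H=-\tfrac12P^{ab}\mathcal R_{ab},\qquad J_b=\mathcal R_{ab}n^a,$$ $$A_{bcd}=\ell_a\overline R^a{}_{bcd}+2\ell^{(2)}\overline\nabla_{[d}K_{c]b}+K_{b[c}\overline\nabla_{d]}\ell^{(2)},\qquad B_{abcd}=\gamma_{af}\overline R^f{}_{bcd}+2\overline\nabla_{[d}(K_{c]b}\ell_a)+2\ell^{(2)}K_{b[c}K_{d]a}.$$ The data is *characteristic* if $\gamma$ is positive semi-definite with $\operatorname{Rad}\gamma\ne\{0\}$ at every point and there is a *foliation function*, i.e. a smooth $\underline u$ with $\lambda:=n(\underline u)\ne0$ everywhere, whose level sets (leaves) are all diffeomorphic. On the leaves let $h$, $\chi$, $\Upsilon$, $\ell_\parallel$ be the pull-backs of $\gamma$, $K$, $Y$, $\ell$ ($\ell_\parallel$ is extended to $\mathcal H$ by $\ell_\parallel(n)=0$), $\ell^\sharp=h^\sharp(\ell_\parallel,\cdot)$,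 $\ell^{(2)}_\sharp=h(\ell^\sharp,\ell^\sharp)$, $h(\chi^\sharp(X),\cdot)=\chi(X,\cdot)$, and $$\omega=\tfrac12Y(n,n),\qquad \eta=\mathcal L_n\ell_\parallel-\Pi(n,\cdot)-\chi(\ell^\sharp,\cdot),\qquad \tau=-\eta-d\log|\lambda|.$$ For $X$ tangent to the leaves let $\widetilde\nabla_nX$ be the tangential part in $\overline\nabla_nX=\widetilde\nabla_nX+\eta(X)n$. For functions $x^A$, $A=1,\dots,m-1$, with $n(x^A)=0$ define $$\Gamma^A_{\mathcal H}=\square_hx^A+(4\omega-\operatorname{tr}_h\chi)\,\ell^\sharp(x^A)+2\,dx^A(\chi^\sharp(\ell^\sharp))-2(\mathcal L_n\ell+\Pi(\cdot,n))(\operatorname{grad}_hx^A),\qquad \Gamma^{\underline u}_{\mathcal H}=\lambda\operatorname{tr}_h\Upsilon+\lambda\Phi,$$ $$\Phi=(\ell^{(2)}-\ell^{(2)}_\sharp)\bigl(2\omega-\operatorname{tr}_h\chi-n(\log|\lambda|)\bigr)-\operatorname{div}_h\ell_\parallel+2(\mathcal L_n\ell)(\ell^\sharp)-2\chi(\ell^\sharp,\ell^\sharp)-n(\ell^{(2)}).$$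 **Lemma.** Let $\mathcal D$ be characteristic hypersurface data with foliation function $\underline u$, and let $\{x^A\}$ be $m-1$ smooth functions on an open set $U\subset\mathcal H$, with $n(x^A)=0$ and with differentials linearly independent at every point of $U$. Express all tensors in the coordinate basis $\{\underline u,x^A\}$ and let $\widetilde\nabla_n\partial_{x^A}=\Omega_A{}^B\partial_{x^B}$. 1. The combination $$\mathcal L_A=J_A-\tfrac12\,n\bigl(h_{AB}\Gamma^B_{\mathcal H}\bigr)+\tfrac12\bigl(\Omega_A{}^Bh_{BC}-\chi_{CA}-\operatorname{tr}_h\chi\,h_{AC}\bigr)\Gamma^C_{\mathcal H}$$ depends neither on $\tau$ nor on $\Upsilon$: if two data sets have the same $(\gamma,\ell,\ell^{(2)})$ and the same $\omega$ on $U$ (their $\tau$ and $\Upsilon$ being arbitrary), then they have the same $\mathcal L_A$ on $U$. 2. The combination $$\mathcal L=H-n\bigl(\lambda^{-1}\Gamma^{\underline u}_{\mathcal H}\bigr)-\lambda^{-1}(\operatorname{tr}_h\chi-2\omega)\Gamma^{\underline u}_{\mathcal H}$$ does not depend on $\Upsilon$: if two data sets have the same $(\gamma,\ell,\ell^{(2)})$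 and the same $\omega$ and $\tau$ on $U$ ($\Upsilon$ being arbitrary), then they have the same $\mathcal L$ on $U$. No gauge condition is imposed on $\ell$ and $\ell^{(2)}$, so both statements hold in every gauge. -/

import Mathlib

open scoped Manifold ContDiff Bundle

noncomputable section

/-- The symmetric bilinear form `𝒜((W,a),(Z,b)) = γ(W,Z) + a ℓ(Z) + b ℓ(W) + a b ℓ⁽²⁾` on `V × ℝ`. -/
def ambientForm {V : Type*} [AddCommGroup V] [Module ℝ V] [TopologicalSpace V]
    [IsTopologicalAddGroup V] [ContinuousSMul ℝ V]
    (γ : V →L[ℝ] V →L[ℝ] ℝ) (ℓ : V →L[ℝ] ℝ) (ℓ₂ : ℝ) : LinearMap.BilinForm ℝ (V × ℝ) :=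
  LinearMap.mk₂ ℝ (fun X X' => γ X.1 X'.1 + X.2 * ℓ X'.1 + X'.2 * ℓ X.1 + X.2 * X'.2 * ℓ₂)
    (fun X X' Z => by simp; ring) (fun c X Z => by simp; ring)
    (fun X Z Z' => by simp; ring) (fun c X Z => by simp; ring)

/-- Metric hypersurface data `{H, γ, ℓ, ℓ⁽²⁾}` on a smooth manifold `H` of dimension `k + 1`
(the model `I` may be with or without boundary). -/
structure MetricHypersurfaceData {k : ℕ} {M : Type*} [TopologicalSpace M]
    (I : ModelWithCorners ℝ (EuclideanSpace ℝ (Fin (k + 1))) M)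
    (H : Type*) [TopologicalSpace H] [ChartedSpace M H] [IsManifold I ∞ H] where
  /-- the symmetric two-covariant tensor field `γ` -/
  γ : ∀ p : H, TangentSpace I p →L[ℝ] TangentSpace I p →L[ℝ] ℝ
  /-- the one-form `ℓ` -/
  ℓ : ∀ p : H, TangentSpace I p →L[ℝ] ℝ
  /-- the scalar `ℓ⁽²⁾` -/
  ℓ₂ : H → ℝ
  γ_symm : ∀ (p : H) (X Z : TangentSpace I p), γ p X Z = γ p Z X
  γ_smooth : ContMDiff I (I.prod 𝓘(ℝ, EuclideanSpace ℝ (Fin (k + 1)) →L[ℝ]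
      EuclideanSpace ℝ (Fin (k + 1)) →L[ℝ] ℝ)) ∞
    (fun p => Bundle.TotalSpace.mk' (EuclideanSpace ℝ (Fin (k + 1)) →L[ℝ]
      EuclideanSpace ℝ (Fin (k + 1)) →L[ℝ] ℝ)
      (E := fun q : H => TangentSpace I q →L[ℝ] TangentSpace I q →L[ℝ] ℝ) p (γ p))
  ℓ_smooth : ContMDiff I (I.prod 𝓘(ℝ, EuclideanSpace ℝ (Fin (k + 1)) →L[ℝ] ℝ)) ∞
    (fun p => Bundle.TotalSpace.mk' (EuclideanSpace ℝ (Fin (k + 1)) →L[ℝ] ℝ)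
      (E := fun q : H => TangentSpace I q →L[ℝ] ℝ) p (ℓ p))
  ℓ₂_smooth : ContMDiff I 𝓘(ℝ, ℝ) ∞ ℓ₂
  nondegenerate : ∀ p : H, (ambientForm (γ p) (ℓ p) (ℓ₂ p)).Nondegenerate

/-- Hypersurface data `{H, γ, ℓ, ℓ⁽²⁾, Y}`. -/
structure HypersurfaceData {k : ℕ} {M : Type*} [TopologicalSpace M]
    (I : ModelWithCorners ℝ (EuclideanSpace ℝ (Fin (k + 1))) M)
    (H : Type*) [TopologicalSpace H] [ChartedSpace M H] [IsManifold I ∞ H]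
    extends MetricHypersurfaceData I H where
  /-- the symmetric two-covariant tensor field `Y` -/
  Y : ∀ p : H, TangentSpace I p →L[ℝ] TangentSpace I p →L[ℝ] ℝ
  Y_symm : ∀ (p : H) (X Z : TangentSpace I p), Y p X Z = Y p Z X
  Y_smooth : ContMDiff I (I.prod 𝓘(ℝ, EuclideanSpace ℝ (Fin (k + 1)) →L[ℝ]
      EuclideanSpace ℝ (Fin (k + 1)) →L[ℝ] ℝ)) ∞
    (fun p => Bundle.TotalSpace.mk' (EuclideanSpace ℝ (Fin (k + 1)) →L[ℝ]
      EuclideanSpace ℝ (Fin (k + 1)) →L[ℝ] ℝ)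
      (E := fun q : H => TangentSpace I q →L[ℝ] TangentSpace I q →L[ℝ] ℝ) p (Y p))

section Manifold

variable {k : ℕ} {M : Type*} [TopologicalSpace M]
  (I : ModelWithCorners ℝ (EuclideanSpace ℝ (Fin (k + 1))) M)
  {H : Type*} [TopologicalSpace H] [ChartedSpace M H]

/-- The differential `df` of a function at a point, as a covector. -/
def differential (f : H → ℝ) (p : H) : TangentSpace I p →L[ℝ] ℝ :=
  mfderiv I 𝓘(ℝ, ℝ) f p

/-- The coordinate functions `{u̲, x¹, …, xᵏ}`; index `0` is `u̲` and index `A.succ` is `x^A`. -/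
def adaptedCoords (u : H → ℝ) (x : Fin k → H → ℝ) : Fin (k + 1) → H → ℝ := Fin.cons u x

/-- The coordinate vector `∂_a` at `p` of the functions `y`: the vector with `dy^b(∂_a) = δ^b_a`
(meaningful where the differentials `dy^b` form a basis of the cotangent space). -/
def coordVec (y : Fin (k + 1) → H → ℝ) (p : H) (a : Fin (k + 1)) : TangentSpace I p :=
  (ContinuousLinearMap.inverse
    (ContinuousLinearMap.pi (fun b => differential I (y b) p) :
      TangentSpace I p →L[ℝ] (Fin (k + 1) → ℝ))) (Pi.single a 1)

/-- The partial derivative `∂_a f` with respect to the coordinates `y`. -/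
def pd (y : Fin (k + 1) → H → ℝ) (a : Fin (k + 1)) (f : H → ℝ) : H → ℝ :=
  fun p => differential I f p (coordVec I y p a)

/-- Two subsets (here: leaves) of `H` are diffeomorphic. -/
def AreDiffeomorphic (S T : Set H) : Prop :=
  ∃ f g : H → H, ContMDiffOn I I ∞ f S ∧ ContMDiffOn I I ∞ g T ∧
    Set.MapsTo f S T ∧ Set.MapsTo g T S ∧ Set.LeftInvOn g f S ∧ Set.LeftInvOn f g T

end Manifold

namespace MetricHypersurfaceData

variable {k : ℕ} {M : Type*} [TopologicalSpace M]
  {I : ModelWithCorners ℝ (EuclideanSpace ℝ (Fin (k + 1))) M}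
  {H : Type*} [TopologicalSpace H] [ChartedSpace M H] [IsManifold I ∞ H]
  (D : MetricHypersurfaceData I H)

/-- The inverse of the isomorphism `V ↦ 𝒜(V, ·)` from `T_pH × ℝ` onto its dual. -/
def sharp (p : H) :
    Module.Dual ℝ (TangentSpace I p × ℝ) →ₗ[ℝ] TangentSpace I p × ℝ :=
  haveI : FiniteDimensional ℝ (TangentSpace I p) :=
    inferInstanceAs (FiniteDimensional ℝ (EuclideanSpace ℝ (Fin (k + 1))))
  (((ambientForm (D.γ p) (D.ℓ p) (D.ℓ₂ p)).toDual (D.nondegenerate p)).symm :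
    Module.Dual ℝ (TangentSpace I p × ℝ) →ₗ[ℝ] TangentSpace I p × ℝ)

/-- The two-contravariant tensor `P`. -/
def P (p : H) (α β : TangentSpace I p →L[ℝ] ℝ) : ℝ :=
  β (D.sharp p ((α : TangentSpace I p →ₗ[ℝ] ℝ) ∘ₗ LinearMap.fst ℝ (TangentSpace I p) ℝ)).1

/-- The vector field `n`. -/
def n (p : H) : TangentSpace I p := (D.sharp p (LinearMap.snd ℝ (TangentSpace I p) ℝ)).1

/-- The scalar `n⁽²⁾`. -/
def n₂ (p : H) : ℝ := (D.sharp p (LinearMap.snd ℝ (TangentSpace I p) ℝ)).2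

/-- The derivative `n(f)` of a function along `n`. -/
def nDeriv (f : H → ℝ) : H → ℝ := fun p => differential I f p (D.n p)

/-- A foliation function: a smooth function `u̲` with `n(u̲) ≠ 0` everywhere. -/
def IsFoliationFunction (u : H → ℝ) : Prop :=
  ContMDiff I 𝓘(ℝ, ℝ) ∞ u ∧ ∀ p, D.nDeriv u p ≠ 0

/-- Characteristic hypersurface data. -/
structure IsCharacteristic : Prop where
  radical_ne_bot : ∀ p : H, ∃ X : TangentSpace I p, X ≠ 0 ∧ ∀ Z, D.γ p X Z = 0
  semipos : ∀ (p : H) (X : TangentSpace I p), 0 ≤ D.γ p X X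
  foliated : ∃ u : H → ℝ, D.IsFoliationFunction u ∧
    ∀ c ∈ Set.range u, ∀ c' ∈ Set.range u, AreDiffeomorphic I (u ⁻¹' {c}) (u ⁻¹' {c'})

end MetricHypersurfaceData

namespace HypersurfaceData

variable {k : ℕ} {M : Type*} [TopologicalSpace M]
  {I : ModelWithCorners ℝ (EuclideanSpace ℝ (Fin (k + 1))) M}
  {H : Type*} [TopologicalSpace H] [ChartedSpace M H] [IsManifold I ∞ H]
  (D : HypersurfaceData I H)

section Hypersurface

/-! Components with respect to coordinates `y` of the objects living on `H`.  Small Latin indices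
run over `Fin (k + 1)`. -/

variable (y : Fin (k + 1) → H → ℝ)

/-- `γ_{ab}` -/
def γc (a b : Fin (k + 1)) : H → ℝ := fun p => D.γ p (coordVec I y p a) (coordVec I y p b)

/-- `ℓ_a` -/
def ℓc (a : Fin (k + 1)) : H → ℝ := fun p => D.ℓ p (coordVec I y p a)

/-- `Y_{ab}` -/
def Yc (a b : Fin (k + 1)) : H → ℝ := fun p => D.Y p (coordVec I y p a) (coordVec I y p b)

/-- `n^a` -/
def nc (a : Fin (k + 1)) : H → ℝ := D.nDeriv (y a)

/-- `P^{ab}` -/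
def Pc (a b : Fin (k + 1)) : H → ℝ := fun p => D.P p (differential I (y a) p) (differential I (y b) p)

/-- Lie derivative along `n` of a one-form, `(𝓛_n α)_a = n^b ∂_b α_a + α_b ∂_a n^b`. -/
def lieN1 (α : Fin (k + 1) → H → ℝ) (a : Fin (k + 1)) : H → ℝ := fun p =>
  ∑ b, (D.nc y b p * pd I y b (α a) p + α b p * pd I y a (D.nc y b) p)

/-- Lie derivative along `n` of a two-covariant tensor. -/
def lieN2 (T : Fin (k + 1) → Fin (k + 1) → H → ℝ) (a b : Fin (k + 1)) : H → ℝ := fun p =>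
  ∑ c, (D.nc y c p * pd I y c (T a b) p + T c b p * pd I y a (D.nc y c) p
    + T a c p * pd I y b (D.nc y c) p)

/-- `K = n⁽²⁾ Y + ½ 𝓛_n γ + ℓ ⊗ₛ dn⁽²⁾` -/
def K (a b : Fin (k + 1)) : H → ℝ := fun p =>
  D.n₂ p * D.Yc y a b p + 1 / 2 * D.lieN2 y (D.γc y) a b p
    + 1 / 2 * (D.ℓc y a p * pd I y b D.n₂ p + D.ℓc y b p * pd I y a D.n₂ p)

/-- `F = ½ dℓ` -/
def F (a b : Fin (k + 1)) : H → ℝ := fun p =>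
  1 / 2 * (pd I y a (D.ℓc y b) p - pd I y b (D.ℓc y a) p)

/-- `Π = Y + F` -/
def Pi' (a b : Fin (k + 1)) : H → ℝ := fun p => D.Yc y a b p + D.F y a b p

/-- Connection coefficients `Γ̄^c_{ab}`, `∇̄_{∂_a} ∂_b = Γ̄^c_{ab} ∂_c`.  This is the Koszul formula for
the unique torsion-free connection `∇̄` with
`∇̄_a γ_{bc} = - ℓ_b K_{ac} - ℓ_c K_{ab}` and `∇̄_a ℓ_b = Y_{ab} + F_{ab} - ℓ⁽²⁾ K_{ab}`. -/
def Γ (c a b : Fin (k + 1)) : H → ℝ := fun p =>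
  1 / 2 * ∑ d, D.Pc y c d p *
      (pd I y a (D.γc y b d) p + pd I y b (D.γc y a d) p - pd I y d (D.γc y a b) p)
    + D.nc y c p * (1 / 2 * (pd I y a (D.ℓc y b) p + pd I y b (D.ℓc y a) p) - D.Yc y a b p)

/-- Curvature `R̄^a_{bcd}` of `∇̄`, with `R̄(∂_c, ∂_d) ∂_b = R̄^a_{bcd} ∂_a`. -/
def curv (a b c d : Fin (k + 1)) : H → ℝ := fun p =>
  pd I y c (D.Γ y a d b) p - pd I y d (D.Γ y a c b) p
    + ∑ e, (D.Γ y a c e p * D.Γ y e d b p - D.Γ y a d e p * D.Γ y e c b p)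

/-- `∇̄_d T_{ab}` -/
def cov2 (T : Fin (k + 1) → Fin (k + 1) → H → ℝ) (d a b : Fin (k + 1)) : H → ℝ := fun p =>
  pd I y d (T a b) p - ∑ e, (D.Γ y e d a p * T e b p + D.Γ y e d b p * T a e p)

/-- `∇̄_d T_{abc}` -/
def cov3 (T : Fin (k + 1) → Fin (k + 1) → Fin (k + 1) → H → ℝ) (d a b c : Fin (k + 1)) :
    H → ℝ := fun p =>
  pd I y d (T a b c) p - ∑ e, (D.Γ y e d a p * T e b c p + D.Γ y e d b p * T a e c p
    + D.Γ y e d c p * T a b e p)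

/-- `A_{bcd} = ℓ_a R̄^a_{bcd} + 2 ℓ⁽²⁾ ∇̄_{[d} K_{c]b} + K_{b[c} ∇̄_{d]} ℓ⁽²⁾` -/
def tensorA (b c d : Fin (k + 1)) : H → ℝ := fun p =>
  ∑ a, D.ℓc y a p * D.curv y a b c d p
    + D.ℓ₂ p * (D.cov2 y (D.K y) d c b p - D.cov2 y (D.K y) c d b p)
    + 1 / 2 * (D.K y b c p * pd I y d D.ℓ₂ p - D.K y b d p * pd I y c D.ℓ₂ p)

/-- The tensor `K_{cb} ℓ_a`, with indices in the order `c, b, a`. -/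
def Kℓ (c b a : Fin (k + 1)) : H → ℝ := fun p => D.K y c b p * D.ℓc y a p

/-- `B_{abcd} = γ_{af} R̄^f_{bcd} + 2 ∇̄_{[d} (K_{c]b} ℓ_a) + 2 ℓ⁽²⁾ K_{b[c} K_{d]a}` -/
def tensorB (a b c d : Fin (k + 1)) : H → ℝ := fun p =>
  ∑ f, D.γc y a f p * D.curv y f b c d p
    + (D.cov3 y (D.Kℓ y) d c b a p - D.cov3 y (D.Kℓ y) c d b a p)
    + D.ℓ₂ p * (D.K y b c p * D.K y d a p - D.K y b d p * D.K y c a p)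

/-- The constraint tensor `ℛ_{ab} = B_{acbd} P^{cd} - (A_{bac} + A_{abc}) n^c`. -/
def Ric (a b : Fin (k + 1)) : H → ℝ := fun p =>
  ∑ c, ∑ d, D.tensorB y a c b d p * D.Pc y c d p
    - ∑ c, (D.tensorA y b a c p + D.tensorA y a b c p) * D.nc y c p

/-- The constraint scalar `H = - ½ P^{ab} ℛ_{ab}`. -/
def Hc : H → ℝ := fun p => -(1 / 2) * ∑ a, ∑ b, D.Pc y a b p * D.Ric y a b p

/-- The constraint one-form `J_b = ℛ_{ab} n^a`. -/
def J (b : Fin (k + 1)) : H → ℝ := fun p => ∑ a, D.Ric y a b p * D.nc y a p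

end Hypersurface

section Foliation

/-! Quantities tangent to the foliation by the level sets of `u`, in the coordinates `{u, x^A}`.
Capital Latin indices run over `Fin k`; the coordinate vector `∂_{x^A}` has index `A.succ`. -/

/-- `ω = ½ Y(n,n)` -/
def omega : H → ℝ := fun p => 1 / 2 * D.Y p (D.n p) (D.n p)

/-- `λ = n(u̲)` -/
def lam (u : H → ℝ) : H → ℝ := D.nDeriv u

variable (u : H → ℝ) (x : Fin k → H → ℝ)

/-- The induced metric `h_{AB}` on the leaves. -/
def h (p : H) : Matrix (Fin k) (Fin k) ℝ :=
  Matrix.of fun A B => D.γc (adaptedCoords u x) A.succ B.succ p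

/-- `h^{AB}` -/
def hInv (A B : Fin k) : H → ℝ := fun p => (D.h u x p)⁻¹ A B

/-- `χ_{AB}`, the pull-back of `K`. -/
def χ (A B : Fin k) : H → ℝ := D.K (adaptedCoords u x) A.succ B.succ

/-- `Υ_{AB}`, the pull-back of `Y`. -/
def Υ (A B : Fin k) : H → ℝ := D.Yc (adaptedCoords u x) A.succ B.succ

/-- `tr_h T = h^{AB} T_{AB}` -/
def tr (T : Fin k → Fin k → H → ℝ) : H → ℝ := fun p => ∑ A, ∑ B, D.hInv u x A B p * T A B p

/-- `ℓ_A`, the components of `ℓ_∥` on the leaves. -/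
def ℓLeaf (A : Fin k) : H → ℝ := D.ℓc (adaptedCoords u x) A.succ

/-- `ℓ_∥` as a one-form on `H`: it agrees with `ℓ` on vectors tangent to the leaves and vanishes
on `n`, that is, `ℓ_∥(V) = ℓ(V - (V(u̲) / λ) n)`. -/
def ℓPar (a : Fin (k + 1)) : H → ℝ := fun p =>
  D.ℓ p (coordVec I (adaptedCoords u x) p a
    - (pd I (adaptedCoords u x) a u p / D.lam u p) • D.n p)

/-- `ℓ^A = h^{AB} ℓ_B` -/
def ℓSharp (A : Fin k) : H → ℝ := fun p => ∑ B, D.hInv u x A B p * D.ℓLeaf u x B p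

/-- `ℓ_♯⁽²⁾ = h_{AB} ℓ^A ℓ^B` -/
def ℓSharp₂ : H → ℝ := fun p =>
  ∑ A, ∑ B, D.h u x p A B * D.ℓSharp u x A p * D.ℓSharp u x B p

/-- `χ^♯(ℓ^♯)^A = h^{AB} χ_{BC} ℓ^C` -/
def χSharpℓ (A : Fin k) : H → ℝ := fun p =>
  ∑ B, ∑ C, D.hInv u x A B p * D.χ u x B C p * D.ℓSharp u x C p

/-- `η = 𝓛_n ℓ_∥ - Π(n,·) - χ(ℓ^♯,·)` on the leaves. -/
def η (A : Fin k) : H → ℝ := fun p =>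
  D.lieN1 (adaptedCoords u x) (D.ℓPar u x) A.succ p
    - ∑ b, D.nc (adaptedCoords u x) b p * D.Pi' (adaptedCoords u x) b A.succ p
    - ∑ B, D.ℓSharp u x B p * D.χ u x B A p

/-- `τ = - η - d(log|λ|)` on the leaves. -/
def τ (A : Fin k) : H → ℝ := fun p =>
  -D.η u x A p - pd I (adaptedCoords u x) A.succ (fun q => Real.log |D.lam u q|) p

/-- Christoffel symbols `Γ^{h,C}_{AB}` of the induced metric on the leaves. -/
def ΓLeaf (C A B : Fin k) : H → ℝ := fun p =>
  1 / 2 * ∑ E, D.hInv u x C E p *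
    (pd I (adaptedCoords u x) A.succ (fun q => D.h u x q B E) p
      + pd I (adaptedCoords u x) B.succ (fun q => D.h u x q A E) p
      - pd I (adaptedCoords u x) E.succ (fun q => D.h u x q A B) p)

/-- The Laplacian `□_h f` on the leaves. -/
def boxLeaf (f : H → ℝ) : H → ℝ := fun p =>
  ∑ A, ∑ B, D.hInv u x A B p *
    (pd I (adaptedCoords u x) A.succ (pd I (adaptedCoords u x) B.succ f) p
      - ∑ C, D.ΓLeaf u x C A B p * pd I (adaptedCoords u x) C.succ f p)

/-- `div_h ℓ_∥` -/
def divℓ : H → ℝ := fun p =>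
  ∑ A, ∑ B, D.hInv u x A B p *
    (pd I (adaptedCoords u x) A.succ (D.ℓLeaf u x B) p
      - ∑ C, D.ΓLeaf u x C A B p * D.ℓLeaf u x C p)

/-- `(𝓛_n ℓ)_A` -/
def lieℓ (A : Fin k) : H → ℝ :=
  D.lieN1 (adaptedCoords u x) (D.ℓc (adaptedCoords u x)) A.succ

/-- `(grad_h f)^A = h^{AB} ∂_B f` -/
def gradLeaf (f : H → ℝ) (A : Fin k) : H → ℝ := fun p =>
  ∑ B, D.hInv u x A B p * pd I (adaptedCoords u x) B.succ f p

/-- `Γ^A_H = □_h x^A + (4ω - tr_h χ) ℓ^♯(x^A) + 2 dx^A(χ^♯(ℓ^♯))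
- 2 (𝓛_n ℓ + Π(·,n))(grad_h x^A)` -/
def ΓA (A : Fin k) : H → ℝ := fun p =>
  D.boxLeaf u x (x A) p
    + (4 * D.omega p - D.tr u x (D.χ u x) p)
      * ∑ B, D.ℓSharp u x B p * pd I (adaptedCoords u x) B.succ (x A) p
    + 2 * ∑ B, D.χSharpℓ u x B p * pd I (adaptedCoords u x) B.succ (x A) p
    - 2 * ∑ B, (D.lieℓ u x B p
        + ∑ c, D.Pi' (adaptedCoords u x) B.succ c p * D.nc (adaptedCoords u x) c p)
      * D.gradLeaf u x (x A) B p

/-- `Φ = (ℓ⁽²⁾ - ℓ_♯⁽²⁾)(2ω - tr_h χ - n(log|λ|)) - div_h ℓ_∥ + 2 (𝓛_n ℓ)(ℓ^♯) - 2 χ(ℓ^♯,ℓ^♯)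
- n(ℓ⁽²⁾)` -/
def Φ : H → ℝ := fun p =>
  (D.ℓ₂ p - D.ℓSharp₂ u x p)
      * (2 * D.omega p - D.tr u x (D.χ u x) p - D.nDeriv (fun q => Real.log |D.lam u q|) p)
    - D.divℓ u x p + 2 * ∑ A, D.lieℓ u x A p * D.ℓSharp u x A p
    - 2 * ∑ A, ∑ B, D.χ u x A B p * D.ℓSharp u x A p * D.ℓSharp u x B p
    - D.nDeriv D.ℓ₂ p

/-- `Γ^{u̲}_H = λ tr_h Υ + λ Φ` -/
def Γu : H → ℝ := fun p => D.lam u p * D.tr u x (D.Υ u x) p + D.lam u p * D.Φ u x p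

/-- `(∇̄_n ∂_{x^A})^c` -/
def nablaN (A : Fin k) (c : Fin (k + 1)) : H → ℝ := fun p =>
  ∑ b, D.nc (adaptedCoords u x) b p * D.Γ (adaptedCoords u x) c b A.succ p

/-- `Ω_A^B`, the coefficients of `∇̃_n ∂_{x^A} = Ω_A^B ∂_{x^B}`, where `∇̃_n X` is the part of `∇̄_n X`
tangent to the leaves in the decomposition `∇̄_n X = ∇̃_n X + η(X) n`. -/
def Ω (A B : Fin k) : H → ℝ := fun p =>
  D.nablaN u x A B.succ p
    - D.nablaN u x A 0 p / D.lam u p * D.nc (adaptedCoords u x) B.succ p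

/-- `𝓛_A = J_A - ½ n(h_{AB} Γ^B_H) + ½ (Ω_A^B h_{BC} - χ_{CA} - tr_h χ h_{AC}) Γ^C_H` -/
def combA (A : Fin k) : H → ℝ := fun p =>
  D.J (adaptedCoords u x) A.succ p
    - 1 / 2 * D.nDeriv (fun q => ∑ B, D.h u x q A B * D.ΓA u x B q) p
    + 1 / 2 * ∑ C, (∑ B, D.Ω u x A B p * D.h u x p B C - D.χ u x C A p
        - D.tr u x (D.χ u x) p * D.h u x p A C) * D.ΓA u x C p

/-- `𝓛 = H - n(λ⁻¹ Γ^{u̲}_H) - λ⁻¹ (tr_h χ - 2ω) Γ^{u̲}_H` -/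
def comb : H → ℝ := fun p =>
  D.Hc (adaptedCoords u x) p - D.nDeriv (fun q => (D.lam u q)⁻¹ * D.Γu u x q) p
    - (D.lam u p)⁻¹ * (D.tr u x (D.χ u x) p - 2 * D.omega p) * D.Γu u x p

end Foliation

end HypersurfaceData

end

/-! The two data sets are compared exactly, not to first order. Write `δY` for the difference of
their tensors `Y`. Everything hinges on how little of the geometry sees `Y`.

For characteristic data `n` spans the radical of `γ`, `ℓ(n) = 1` and `n⁽²⁾ = 0`. In the coordinates
`{u, x^A}` this gives `n = λ ∂_0`, `λ ℓ_0 = 1`, `γ_{0a} = 0` and `K = ½ 𝓛_n γ`. Hence `K` is the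
same for both data sets and `K_{0a} = 0`. The connection coefficients contain `Y` only through `-n^c
Y_{ab}`, so the sole change is `δΓ̄^0_{ab} = -λ δY_{ab}` (`Γ_diff`). Curvature, `A`, `B` and `ℛ`
then change by explicit expressions in `δY`. Their quadratic part comes from `Γ̄^0_{a0} Γ̄^0_{0b} -
Γ̄^0_{00} Γ̄^0_{ab}`, and it vanishes in both statements: in the first it is needed only for `b =
0`, in the second `δY(n,·) = 0`. Equality of `ω` means `δY(n,n) = 0`, and equality of `τ` in
addition means `δY(n,·) = 0`.

Statement 1. With `z_A = δY(∂_A, n)` one finds `δJ_A = -n(z_A) - tr_h χ z_A` (`J_diff`) and `h_{AB}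
δΓ^B_H = -2 z_A` (`sum_h_ΓA_diff`). Since `Ω_A^B = χ_A^B`, the coefficients `Ω` and `χ` cancel in
`𝓛_A`, and what remains of `δ𝓛_A` is zero.

Statement 2. With `t = h^{AB} δY_{AB}` one finds `δH = n(t) + (tr_h χ - 2ω) t` (`Hc_diff`). The
formula uses `n(h^{AB}) = -2 χ^{AB}` to absorb the contraction of `χ` with `δY`. As `Φ` is common to
both data sets, `δ(λ⁻¹ Γ^{u̲}_H) = t`, and `𝓛` is unchanged.

The components `P^{00}` and `P^{0A}`, which carry `ℓ⁽²⁾` and `ℓ_A`, meet only tensors annihilated by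
the corresponding slots, so no gauge condition enters. Smoothness of all components on `U` is needed
to apply the product rule to functions of `δY`. -/

/-! ### Differentials of functions and smoothness of contractions. -/

section Calculus

variable {k : ℕ} {M : Type*} [TopologicalSpace M]
  {I : ModelWithCorners ℝ (EuclideanSpace ℝ (Fin (k + 1))) M}
  {H : Type*} [TopologicalSpace H] [ChartedSpace M H]

theorem differential_congr {U : Set H} (hU : IsOpen U) {p : H} (hp : p ∈ U) {f g : H → ℝ}
    (h : ∀ q ∈ U, f q = g q) : differential I f p = differential I g p :=
  Filter.EventuallyEq.mfderiv_eq (Filter.eventually_of_mem (hU.mem_nhds hp) h)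

theorem differential_const (c : ℝ) (p : H) : differential I (fun _ : H => c) p = 0 :=
  mfderiv_const

theorem differential_add {f g : H → ℝ} {p : H} (hf : MDifferentiableAt I 𝓘(ℝ, ℝ) f p)
    (hg : MDifferentiableAt I 𝓘(ℝ, ℝ) g p) :
    differential I (fun q => f q + g q) p = differential I f p + differential I g p :=
  (hf.hasMFDerivAt.add hg.hasMFDerivAt).mfderiv

theorem differential_sub {f g : H → ℝ} {p : H} (hf : MDifferentiableAt I 𝓘(ℝ, ℝ) f p)
    (hg : MDifferentiableAt I 𝓘(ℝ, ℝ) g p) :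
    differential I (fun q => f q - g q) p = differential I f p - differential I g p :=
  (hf.hasMFDerivAt.sub hg.hasMFDerivAt).mfderiv

theorem differential_mul {f g : H → ℝ} {p : H} (hf : MDifferentiableAt I 𝓘(ℝ, ℝ) f p)
    (hg : MDifferentiableAt I 𝓘(ℝ, ℝ) g p) :
    differential I (fun q => f q * g q) p
      = f p • differential I g p + g p • differential I f p :=
  (hf.hasMFDerivAt.mul hg.hasMFDerivAt).mfderiv

theorem differential_sum {ι : Type*} (s : Finset ι) {f : ι → H → ℝ} {p : H}
    (hf : ∀ i ∈ s, MDifferentiableAt I 𝓘(ℝ, ℝ) (f i) p) :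
    differential I (fun q => ∑ i ∈ s, f i q) p = ∑ i ∈ s, differential I (f i) p := by
  classical
  suffices h : MDifferentiableAt I 𝓘(ℝ, ℝ) (fun q => ∑ i ∈ s, f i q) p ∧
      differential I (fun q => ∑ i ∈ s, f i q) p = ∑ i ∈ s, differential I (f i) p from h.2
  induction s using Finset.induction_on with
  | empty => exact ⟨mdifferentiableAt_const, differential_const 0 p⟩
  | insert i s hi ih =>
    have hs := ih fun j hj => hf j (by simp [hj])
    have hi' := hf i (by simp)
    simp only [Finset.sum_insert hi]
    exact ⟨hi'.add hs.1, (differential_add hi' hs.1).trans (by rw [hs.2])⟩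

/-- The entries of the inverse of a smooth invertible matrix are smooth. -/
theorem contMDiffOn_matrix_inv {ι : Type*} [Fintype ι] [DecidableEq ι] {U : Set H}
    {m : H → Matrix ι ι ℝ} (hm : ∀ i j, ContMDiffOn I 𝓘(ℝ, ℝ) ∞ (fun p => m p i j) U)
    (hdet : ∀ p ∈ U, (m p).det ≠ 0) (i j : ι) :
    ContMDiffOn I 𝓘(ℝ, ℝ) ∞ (fun p => (m p)⁻¹ i j) U := by
  have det_smooth : ∀ m' : H → Matrix ι ι ℝ,
      (∀ i j, ContMDiffOn I 𝓘(ℝ, ℝ) ∞ (fun p => m' p i j) U) →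
      ContMDiffOn I 𝓘(ℝ, ℝ) ∞ (fun p => (m' p).det) U := by
    intro m' hm'
    simp only [Matrix.det_apply']
    exact contMDiffOn_finsetSum fun σ _ => contMDiffOn_const.mul
      (contMDiffOn_finsetProd fun i _ => hm' _ _)
  have hadj : ContMDiffOn I 𝓘(ℝ, ℝ) ∞ (fun p => (m p).adjugate i j) U := by
    simp only [Matrix.adjugate_apply]
    refine det_smooth _ fun a b => ?_
    by_cases h : a = j
    · subst h
      simpa using contMDiffOn_const
    · simpa [Matrix.updateRow_apply, h] using hm a b
  refine (((det_smooth m hm).inv₀ hdet).mul hadj).congr fun p hp => ?_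
  simp [Matrix.inv_def]

variable [IsManifold I ∞ H]

/-- The derivative of a smooth function along a smooth vector field is smooth. -/
theorem contMDiffOn_differential_apply {U : Set H} (hU : IsOpen U) {f : H → ℝ}
    (hf : ContMDiffOn I 𝓘(ℝ, ℝ) ∞ f U) {W : ∀ p : H, TangentSpace I p}
    (hW : ContMDiffOn I (I.prod 𝓘(ℝ, EuclideanSpace ℝ (Fin (k + 1)))) ∞
      (fun p => (⟨p, W p⟩ : TangentBundle I H)) U) :
    ContMDiffOn I 𝓘(ℝ, ℝ) ∞ (fun p => differential I f p (W p)) U := by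
  -- `df(W)` is the fibre component of the tangent map of `f` composed with the section `W`.
  have h1 := hf.contMDiffOn_tangentMapWithin (m := ∞) (by simp) hU.uniqueMDiffOn
  have h2 := h1.comp hW (fun p hp => hp)
  have h3 := (contMDiff_snd_tangentBundle_modelSpace ℝ 𝓘(ℝ, ℝ) (n := ∞)).comp_contMDiffOn h2
  refine h3.congr fun p hp => ?_
  simp only [Function.comp, tangentMapWithin, differential]
  rw [mfderivWithin_of_isOpen hU hp]
  rfl

theorem contMDiffOn_covector_apply {U : Set H} {α : ∀ p : H, TangentSpace I p →L[ℝ] ℝ}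
    (hα : ContMDiff I (I.prod 𝓘(ℝ, EuclideanSpace ℝ (Fin (k + 1)) →L[ℝ] ℝ)) ∞
      (fun p => Bundle.TotalSpace.mk' (EuclideanSpace ℝ (Fin (k + 1)) →L[ℝ] ℝ)
        (E := fun q : H => TangentSpace I q →L[ℝ] ℝ) p (α p)))
    {W : ∀ p : H, TangentSpace I p}
    (hW : ContMDiffOn I (I.prod 𝓘(ℝ, EuclideanSpace ℝ (Fin (k + 1)))) ∞
      (fun p => (⟨p, W p⟩ : TangentBundle I H)) U) :
    ContMDiffOn I 𝓘(ℝ, ℝ) ∞ (fun p => α p (W p)) U := by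
  have : ContMDiffOn I (I.prod 𝓘(ℝ, ℝ)) ∞
      (fun p => Bundle.TotalSpace.mk' ℝ (E := Bundle.Trivial H ℝ) p (α p (W p))) U := by
    apply ContMDiffOn.clm_bundle_apply (F₁ := EuclideanSpace ℝ (Fin (k + 1)))
    · exact hα.contMDiffOn
    · exact hW
  intro p hp
  have h := this p hp
  simp only [Bundle.contMDiffWithinAt_totalSpace] at h
  exact h.2

theorem contMDiffOn_bilin_apply {U : Set H}
    {T : ∀ p : H, TangentSpace I p →L[ℝ] TangentSpace I p →L[ℝ] ℝ}
    (hT : ContMDiff I (I.prod 𝓘(ℝ, EuclideanSpace ℝ (Fin (k + 1)) →L[ℝ]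
      EuclideanSpace ℝ (Fin (k + 1)) →L[ℝ] ℝ)) ∞
      (fun p => Bundle.TotalSpace.mk' (EuclideanSpace ℝ (Fin (k + 1)) →L[ℝ]
        EuclideanSpace ℝ (Fin (k + 1)) →L[ℝ] ℝ)
        (E := fun q : H => TangentSpace I q →L[ℝ] TangentSpace I q →L[ℝ] ℝ) p (T p)))
    {V W : ∀ p : H, TangentSpace I p}
    (hV : ContMDiffOn I (I.prod 𝓘(ℝ, EuclideanSpace ℝ (Fin (k + 1)))) ∞
      (fun p => (⟨p, V p⟩ : TangentBundle I H)) U)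
    (hW : ContMDiffOn I (I.prod 𝓘(ℝ, EuclideanSpace ℝ (Fin (k + 1)))) ∞
      (fun p => (⟨p, W p⟩ : TangentBundle I H)) U) :
    ContMDiffOn I 𝓘(ℝ, ℝ) ∞ (fun p => T p (V p) (W p)) U := by
  have : ContMDiffOn I (I.prod 𝓘(ℝ, ℝ)) ∞
      (fun p => Bundle.TotalSpace.mk' ℝ (E := Bundle.Trivial H ℝ) p (T p (V p) (W p))) U := by
    apply ContMDiffOn.clm_bundle_apply₂ (F₁ := EuclideanSpace ℝ (Fin (k + 1)))
      (F₂ := EuclideanSpace ℝ (Fin (k + 1)))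
    · exact hT.contMDiffOn
    · exact hV
    · exact hW
  intro p hp
  have h := this p hp
  simp only [Bundle.contMDiffWithinAt_totalSpace] at h
  exact h.2

end Calculus

/-! ### Coordinate vector fields of functions with independent differentials. -/

section CoordVec

variable {k : ℕ} {M : Type*} [TopologicalSpace M]
  {I : ModelWithCorners ℝ (EuclideanSpace ℝ (Fin (k + 1))) M}
  {H : Type*} [TopologicalSpace H] [ChartedSpace M H]
  {y : Fin (k + 1) → H → ℝ} {p : H}

/-- The differentials of coordinates, as a linear equivalence. -/
theorem exists_equiv_of_linearIndependent
    (hy : LinearIndependent ℝ fun b => differential I (y b) p) :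
    ∃ e : TangentSpace I p ≃L[ℝ] (Fin (k + 1) → ℝ),
      (e : TangentSpace I p →L[ℝ] (Fin (k + 1) → ℝ)) =
        ContinuousLinearMap.pi fun b => differential I (y b) p := by
  have hfd : FiniteDimensional ℝ (TangentSpace I p) :=
    inferInstanceAs (FiniteDimensional ℝ (EuclideanSpace ℝ (Fin (k + 1))))
  have hfr : Module.finrank ℝ (TangentSpace I p) = k + 1 :=
    (finrank_euclideanSpace_fin : Module.finrank ℝ (EuclideanSpace ℝ (Fin (k + 1))) = k + 1)
  have hT2 : T2Space (TangentSpace I p) :=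
    inferInstanceAs (T2Space (EuclideanSpace ℝ (Fin (k + 1))))
  set L : TangentSpace I p →L[ℝ] (Fin (k + 1) → ℝ) :=
    ContinuousLinearMap.pi fun b => differential I (y b) p with hL
  have hli : LinearIndependent ℝ
      fun b => ((differential I (y b) p : TangentSpace I p →ₗ[ℝ] ℝ) : Module.Dual ℝ _) :=
    hy.map' (ContinuousLinearMap.coeLM ℝ) (by
      rw [LinearMap.ker_eq_bot]; exact ContinuousLinearMap.coe_injective)
  -- There are as many independent covectors `dy^b` as the dimension, so they span the dual; a
  -- vector killed by all of them is killed by every functional.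
  have hspan := hli.span_eq_top_of_card_eq_finrank' (by simp [Subspace.dual_finrank_eq, hfr])
  have hinj : Function.Injective L := by
    rw [injective_iff_map_eq_zero]
    intro v hv
    rw [← Module.forall_dual_apply_eq_zero_iff ℝ v]
    intro φ
    have hφ : φ ∈ Submodule.span ℝ (Set.range fun b =>
        ((differential I (y b) p : TangentSpace I p →ₗ[ℝ] ℝ) : Module.Dual ℝ _)) := by
      rw [hspan]; trivial
    induction hφ using Submodule.span_induction with
    | mem ψ hψ =>
      obtain ⟨b, rfl⟩ := hψ
      exact congrFun hv b
    | zero => rfl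
    | add ψ ψ' _ _ h h' => simp [h, h']
    | smul c ψ _ h => simp [h]
  refine ⟨(LinearEquiv.ofInjectiveOfFinrankEq (L : TangentSpace I p →ₗ[ℝ] (Fin (k + 1) → ℝ))
    hinj (by simp [hfr])).toContinuousLinearEquiv, ?_⟩
  ext v
  rfl

theorem differential_coordVec (hy : LinearIndependent ℝ fun b => differential I (y b) p)
    (a b : Fin (k + 1)) :
    differential I (y b) p (coordVec I y p a) = (Pi.single a 1 : Fin (k + 1) → ℝ) b := by
  obtain ⟨e, he⟩ := exists_equiv_of_linearIndependent hy
  have h1 : differential I (y b) p (coordVec I y p a) = e (coordVec I y p a) b := by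
    have := congrArg (fun L : TangentSpace I p →L[ℝ] (Fin (k + 1) → ℝ) => L (coordVec I y p a) b) he
    exact this.symm
  rw [h1, coordVec, ← he, ContinuousLinearMap.inverse_equiv]
  simp

/-- Every tangent vector is the combination of the coordinate vectors with its own components. -/
theorem eq_sum_coordVec (hy : LinearIndependent ℝ fun b => differential I (y b) p)
    (v : TangentSpace I p) : v = ∑ a, differential I (y a) p v • coordVec I y p a := by
  obtain ⟨e, he⟩ := exists_equiv_of_linearIndependent hy
  apply e.injective
  have h1 : ∀ w b, e w b = differential I (y b) p w := by
    intro w b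
    exact congrArg (fun L : TangentSpace I p →L[ℝ] (Fin (k + 1) → ℝ) => L w b) he
  ext b
  rw [h1, h1, map_sum]
  simp [differential_coordVec hy, Pi.single_apply]

variable [IsManifold I ∞ H]

/-- The coordinate vector fields of smooth coordinates are smooth. -/
theorem contMDiffOn_coordVec {U : Set H} (hU : IsOpen U)
    (hys : ∀ b, ContMDiffOn I 𝓘(ℝ, ℝ) ∞ (y b) U)
    (hy : ∀ p ∈ U, LinearIndependent ℝ fun b => differential I (y b) p) (a : Fin (k + 1)) :
    ContMDiffOn I (I.prod 𝓘(ℝ, EuclideanSpace ℝ (Fin (k + 1)))) ∞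
      (fun p => (⟨p, coordVec I y p a⟩ : TangentBundle I H)) U := by
  intro p₀ hp₀
  set e := trivializationAt (EuclideanSpace ℝ (Fin (k + 1))) (TangentSpace I : H → Type _) p₀
  set b := (EuclideanSpace.basisFun (Fin (k + 1)) ℝ).toBasis
  set V := U ∩ e.baseSet with hV
  have hVo : IsOpen V := hU.inter e.open_baseSet
  have hp₀V : p₀ ∈ V := ⟨hp₀, FiberBundle.mem_baseSet_trivializationAt' p₀⟩
  have hW : ∀ i, ContMDiffOn I (I.prod 𝓘(ℝ, EuclideanSpace ℝ (Fin (k + 1)))) ∞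
      (fun p => (⟨p, e.localFrame b i p⟩ : TangentBundle I H)) V := fun i =>
    (e.contMDiffOn_localFrame_baseSet ∞ b i).mono Set.inter_subset_right
  -- The Jacobian of `y` in a smooth local frame of the tangent bundle. The frame components of
  -- `∂_a` are a column of its inverse, so they are smooth.
  set m : H → Matrix (Fin (k + 1)) (Fin (k + 1)) ℝ :=
    fun p => Matrix.of fun c i => differential I (y c) p (e.localFrame b i p) with hm
  have hms : ∀ c i, ContMDiffOn I 𝓘(ℝ, ℝ) ∞ (fun p => m p c i) V := fun c i =>
    contMDiffOn_differential_apply hVo ((hys c).mono Set.inter_subset_left) (hW i)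
  have hinv : ∀ p ∈ V, m p * Matrix.of (fun i c =>
      e.localFrameCoeff I b i p (coordVec I y p c)) = 1 := by
    intro p hp
    ext c d
    have h1 := e.eq_sum_localFrameCoeff_smul (I := I) (b := b) hp.2 (s := fun q => coordVec I y q d)
    have h2 := differential_coordVec (hy p hp.1) d c
    rw [h1, map_sum] at h2
    simp only [map_smul, smul_eq_mul] at h2
    simp only [Matrix.mul_apply, Matrix.one_apply, hm, Matrix.of_apply]
    rw [Pi.single_apply] at h2
    rw [← h2]
    exact Finset.sum_congr rfl fun i _ => mul_comm _ _
  have hdet : ∀ p ∈ V, (m p).det ≠ 0 := fun p hp h0 => by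
    have := congrArg Matrix.det (hinv p hp)
    simp [h0] at this
  have hsum : ContMDiffOn I (I.prod 𝓘(ℝ, EuclideanSpace ℝ (Fin (k + 1)))) ∞
      (fun p => (⟨p, ∑ i, (m p)⁻¹ i a • e.localFrame b i p⟩ : TangentBundle I H)) V :=
    ContMDiffOn.sum_section fun i _ =>
      (contMDiffOn_matrix_inv hms hdet i a).smul_section (hW i)
  refine ((hsum.congr fun p hp => ?_).contMDiffAt (hVo.mem_nhds hp₀V)).contMDiffWithinAt
  have h1 := e.eq_sum_localFrameCoeff_smul (I := I) (b := b) hp.2 (s := fun q => coordVec I y q a)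
  rw [Matrix.inv_eq_right_inv (hinv p hp)]
  simp only [Matrix.of_apply]
  rw [← h1]

theorem contMDiffOn_pd {U : Set H} (hU : IsOpen U)
    (hys : ∀ b, ContMDiffOn I 𝓘(ℝ, ℝ) ∞ (y b) U)
    (hy : ∀ p ∈ U, LinearIndependent ℝ fun b => differential I (y b) p) (a : Fin (k + 1))
    {f : H → ℝ} (hf : ContMDiffOn I 𝓘(ℝ, ℝ) ∞ f U) : ContMDiffOn I 𝓘(ℝ, ℝ) ∞ (pd I y a f) U :=
  contMDiffOn_differential_apply hU hf (contMDiffOn_coordVec hU hys hy a)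

end CoordVec

/-! ### The vector `n` and the tensor `P` of characteristic data. -/

namespace MetricHypersurfaceData

variable {k : ℕ} {M : Type*} [TopologicalSpace M]
  {I : ModelWithCorners ℝ (EuclideanSpace ℝ (Fin (k + 1))) M}
  {H : Type*} [TopologicalSpace H] [ChartedSpace M H] [IsManifold I ∞ H]
  {D : MetricHypersurfaceData I H}

theorem ambientForm_sharp (D : MetricHypersurfaceData I H) (p : H)
    (φ : Module.Dual ℝ (TangentSpace I p × ℝ)) (Z : TangentSpace I p) (b : ℝ) :
    D.γ p (D.sharp p φ).1 Z + (D.sharp p φ).2 * D.ℓ p Z + b * D.ℓ p (D.sharp p φ).1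
      + (D.sharp p φ).2 * b * D.ℓ₂ p = φ (Z, b) := by
  have : FiniteDimensional ℝ (TangentSpace I p) :=
    inferInstanceAs (FiniteDimensional ℝ (EuclideanSpace ℝ (Fin (k + 1))))
  have := LinearMap.BilinForm.apply_toDual_symm_apply (B := ambientForm (D.γ p) (D.ℓ p) (D.ℓ₂ p))
    (hB := D.nondegenerate p) φ (Z, b)
  exact this

theorem sharp_eq (D : MetricHypersurfaceData I H) (p : H)
    (φ : Module.Dual ℝ (TangentSpace I p × ℝ)) (V : TangentSpace I p × ℝ)
    (h : ∀ Z b, D.γ p V.1 Z + V.2 * D.ℓ p Z + b * D.ℓ p V.1 + V.2 * b * D.ℓ₂ p = φ (Z, b)) :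
    D.sharp p φ = V := by
  refine sub_eq_zero.1 ((D.nondegenerate p).1 _ fun X => ?_)
  rw [map_sub, LinearMap.sub_apply, sub_eq_zero]
  exact (D.ambientForm_sharp p φ X.1 X.2).trans (h X.1 X.2).symm

/-- For characteristic data, `n` spans the radical of `γ`, `ℓ(n) = 1` and `n⁽²⁾ = 0`. -/
theorem IsCharacteristic.n_spec (hD : D.IsCharacteristic) (p : H) :
    (∀ Z, D.γ p (D.n p) Z = 0) ∧ D.ℓ p (D.n p) = 1 ∧ D.n₂ p = 0 := by
  obtain ⟨X, hX, hγ⟩ := hD.radical_ne_bot p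
  -- If `ℓ(X) = 0`, the vector `(X, 0)` would be `𝒜`-orthogonal to everything, against
  -- non-degeneracy.
  have hℓ : D.ℓ p X ≠ 0 := fun h0 => hX <| by
    have := D.sharp_eq p 0 (X, 0) (by simp [hγ, h0])
    simpa using (congrArg Prod.fst this).symm
  have hs := D.sharp_eq p (LinearMap.snd ℝ (TangentSpace I p) ℝ) ((D.ℓ p X)⁻¹ • X, 0)
    (by simp [hγ, hℓ])
  have hn : D.n p = (D.ℓ p X)⁻¹ • X := congrArg Prod.fst hs
  refine ⟨fun Z => ?_, ?_, congrArg Prod.snd hs⟩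
  · simp [hn, hγ]
  · simp [hn, hℓ]

/-- The vector `P(α, ·)` for characteristic data. -/
theorem IsCharacteristic.exists_P (hD : D.IsCharacteristic) (p : H)
    (α : TangentSpace I p →L[ℝ] ℝ) :
    ∃ V : TangentSpace I p, (∀ β, D.P p α β = β V) ∧
      (∀ Z, D.γ p V Z + α (D.n p) * D.ℓ p Z = α Z) ∧
      D.ℓ p V + α (D.n p) * D.ℓ₂ p = 0 := by
  obtain ⟨hγ, hℓ, -⟩ := hD.n_spec p
  set φ := (α : TangentSpace I p →ₗ[ℝ] ℝ) ∘ₗ LinearMap.fst ℝ (TangentSpace I p) ℝ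
  have h0 := fun Z => D.ambientForm_sharp p φ Z 0
  have h1 := D.ambientForm_sharp p φ 0 1
  -- Pairing with `(n, 0)` isolates the scalar component of the inverse image, because `γ(·, n) = 0`
  -- and `ℓ(n) = 1`.
  have hα : α (D.n p) = (D.sharp p φ).2 := by
    have := h0 (D.n p)
    rw [D.γ_symm, hγ, hℓ] at this
    simpa [φ] using this.symm
  refine ⟨(D.sharp p φ).1, fun β => rfl, fun Z => ?_, ?_⟩
  · rw [hα]
    simpa [φ] using h0 Z
  · rw [hα]
    simpa [φ] using h1

end MetricHypersurfaceData

/-! ### Adapted coordinates: components of `n`, `γ`, `ℓ` and `P`. -/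

namespace HypersurfaceData

variable {k : ℕ} {M : Type*} [TopologicalSpace M]
  {I : ModelWithCorners ℝ (EuclideanSpace ℝ (Fin (k + 1))) M}
  {H : Type*} [TopologicalSpace H] [ChartedSpace M H] [IsManifold I ∞ H]

/-- The functions `{u, x^A}` are coordinates on `U` adapted to the foliation and to `n`. -/
structure IsAdapted (D : HypersurfaceData I H) (u : H → ℝ) (x : Fin k → H → ℝ) (U : Set H) :
    Prop where
  isCharacteristic : D.IsCharacteristic
  isFoliationFunction : D.IsFoliationFunction u
  isOpen : IsOpen U
  smooth : ∀ A, ContMDiffOn I 𝓘(ℝ, ℝ) ∞ (x A) U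
  linearIndependent : ∀ p ∈ U, LinearIndependent ℝ (fun A => differential I (x A) p)
  nDeriv_eq_zero : ∀ p ∈ U, ∀ A, D.nDeriv (x A) p = 0

variable {D D₁ D₂ : HypersurfaceData I H} {u : H → ℝ} {x : Fin k → H → ℝ} {U : Set H} {p : H}

theorem γc_symm (D : HypersurfaceData I H) (y : Fin (k + 1) → H → ℝ) (a b : Fin (k + 1)) :
    D.γc y a b = D.γc y b a := funext fun _ => D.γ_symm _ _ _

theorem Yc_symm (D : HypersurfaceData I H) (y : Fin (k + 1) → H → ℝ) (a b : Fin (k + 1)) :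
    D.Yc y a b = D.Yc y b a := funext fun _ => D.Y_symm _ _ _

namespace IsAdapted

theorem lam_ne_zero (hA : D.IsAdapted u x U) (p : H) : D.lam u p ≠ 0 :=
  hA.isFoliationFunction.2 p

theorem coords_smooth (hA : D.IsAdapted u x U) (a : Fin (k + 1)) :
    ContMDiffOn I 𝓘(ℝ, ℝ) ∞ (adaptedCoords u x a) U := by
  refine Fin.cases ?_ (fun A => ?_) a
  · exact hA.isFoliationFunction.1.contMDiffOn
  · exact hA.smooth A

/-- The `dx^A` all annihilate `n`, whereas `du(n) = λ ≠ 0`, so `du` is outside their span. -/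
theorem coords_linearIndependent (hA : D.IsAdapted u x U) (hp : p ∈ U) :
    LinearIndependent ℝ fun a => differential I (adaptedCoords u x a) p := by
  have : (fun a => differential I (adaptedCoords u x a) p)
      = Fin.cons (differential I u p) fun A => differential I (x A) p := by
    ext a : 1
    refine Fin.cases ?_ (fun A => ?_) a <;> rfl
  rw [this, linearIndependent_finCons]
  refine ⟨hA.linearIndependent p hp, fun hmem => hA.lam_ne_zero p ?_⟩
  change differential I u p (D.n p) = 0
  generalize differential I u p = φ at hmem ⊢
  induction hmem using Submodule.span_induction with
  | mem ψ hψ =>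
    obtain ⟨A, rfl⟩ := hψ
    exact hA.nDeriv_eq_zero p hp A
  | zero => rfl
  | add ψ ψ' _ _ h h' => simp [h, h']
  | smul c ψ _ h => simp [h]

theorem pd_coord (hA : D.IsAdapted u x U) (hp : p ∈ U) (a b : Fin (k + 1)) :
    pd I (adaptedCoords u x) a (adaptedCoords u x b) p = if b = a then 1 else 0 := by
  rw [pd, differential_coordVec (hA.coords_linearIndependent hp), Pi.single_apply]

theorem pd_x (hA : D.IsAdapted u x U) (hp : p ∈ U) (A B : Fin k) :
    pd I (adaptedCoords u x) A.succ (x B) p = if B = A then 1 else 0 := by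
  have := hA.pd_coord hp A.succ B.succ
  simp only [Fin.succ_inj] at this
  exact this

theorem nc_zero (D : HypersurfaceData I H) (u : H → ℝ) (x : Fin k → H → ℝ) :
    D.nc (adaptedCoords u x) 0 = D.lam u := rfl

theorem nc_succ (hA : D.IsAdapted u x U) (hp : p ∈ U) (A : Fin k) :
    D.nc (adaptedCoords u x) A.succ p = 0 := hA.nDeriv_eq_zero p hp A

theorem n_eq (hA : D.IsAdapted u x U) (hp : p ∈ U) :
    D.n p = D.lam u p • coordVec I (adaptedCoords u x) p 0 := by
  have h := eq_sum_coordVec (hA.coords_linearIndependent hp) (D.n p)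
  rw [Fin.sum_univ_succ, Finset.sum_eq_zero, add_zero] at h
  · exact h
  · intro A _
    have : differential I (adaptedCoords u x A.succ) p (D.n p) = 0 := hA.nc_succ hp A
    rw [this, zero_smul]

theorem nDeriv_eq (hA : D.IsAdapted u x U) (hp : p ∈ U) (f : H → ℝ) :
    D.nDeriv f p = D.lam u p * pd I (adaptedCoords u x) 0 f p := by
  rw [MetricHypersurfaceData.nDeriv, hA.n_eq hp, map_smul, smul_eq_mul, pd]

theorem γc_zero (hA : D.IsAdapted u x U) (hp : p ∈ U) (a : Fin (k + 1)) :
    D.γc (adaptedCoords u x) 0 a p = 0 := by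
  have h := (hA.isCharacteristic.n_spec p).1 (coordVec I (adaptedCoords u x) p a)
  rw [hA.n_eq hp] at h
  rw [map_smul, smul_apply, smul_eq_mul] at h
  exact (mul_eq_zero.1 h).resolve_left (hA.lam_ne_zero p)

theorem γc_zero' (hA : D.IsAdapted u x U) (hp : p ∈ U) (a : Fin (k + 1)) :
    D.γc (adaptedCoords u x) a 0 p = 0 := by
  rw [D.γc_symm, hA.γc_zero hp]

theorem lam_mul_ℓc_zero (hA : D.IsAdapted u x U) (hp : p ∈ U) :
    D.lam u p * D.ℓc (adaptedCoords u x) 0 p = 1 := by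
  have h := (hA.isCharacteristic.n_spec p).2.1
  rw [hA.n_eq hp, map_smul, smul_eq_mul] at h
  exact h

theorem two_mul_omega (hA : D.IsAdapted u x U) (hp : p ∈ U) :
    2 * D.omega p = D.lam u p ^ 2 * D.Yc (adaptedCoords u x) 0 0 p := by
  rw [omega, hA.n_eq hp]
  simp [Yc]
  ring

/-- Together with `sum_Pc_ℓc` this is `𝒜^♯ 𝒜 = id` in components, with `n⁽²⁾ = 0`; all components of
`P` are solved from these two relations. -/
theorem sum_Pc_γc (hA : D.IsAdapted u x U) (hp : p ∈ U) (a c : Fin (k + 1)) :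
    ∑ b, D.Pc (adaptedCoords u x) a b p * D.γc (adaptedCoords u x) b c p
      + D.nc (adaptedCoords u x) a p * D.ℓc (adaptedCoords u x) c p = if a = c then 1 else 0 := by
  obtain ⟨V, hV, h1, -⟩ := hA.isCharacteristic.exists_P p (differential I (adaptedCoords u x a) p)
  have h2 := h1 (coordVec I (adaptedCoords u x) p c)
  rw [differential_coordVec (hA.coords_linearIndependent hp), Pi.single_apply] at h2
  rw [← h2, eq_sum_coordVec (hA.coords_linearIndependent hp) V]
  simp [Pc, hV, γc, ℓc, nc, MetricHypersurfaceData.nDeriv]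

theorem sum_Pc_ℓc (hA : D.IsAdapted u x U) (hp : p ∈ U) (a : Fin (k + 1)) :
    ∑ b, D.Pc (adaptedCoords u x) a b p * D.ℓc (adaptedCoords u x) b p
      + D.nc (adaptedCoords u x) a p * D.ℓ₂ p = 0 := by
  obtain ⟨V, hV, -, h1⟩ := hA.isCharacteristic.exists_P p (differential I (adaptedCoords u x a) p)
  rw [← h1, eq_sum_coordVec (hA.coords_linearIndependent hp) V]
  simp [Pc, hV, ℓc, nc, MetricHypersurfaceData.nDeriv]

/-- Since `γ_{0C} = 0` and `n^A = 0`, the tangential block of the inversion relation closes on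
itself. Invertibility of `h` is thus inherited from non-degeneracy of `𝒜`. -/
theorem P_mul_h (hA : D.IsAdapted u x U) (hp : p ∈ U) :
    (Matrix.of fun A B : Fin k => D.Pc (adaptedCoords u x) A.succ B.succ p) * D.h u x p = 1 := by
  ext A C
  have := hA.sum_Pc_γc hp A.succ C.succ
  rw [Fin.sum_univ_succ, hA.γc_zero hp, hA.nc_succ hp] at this
  simpa [Matrix.mul_apply, h, Matrix.one_apply] using this

theorem isUnit_det_h (hA : D.IsAdapted u x U) (hp : p ∈ U) : IsUnit (D.h u x p).det :=
  Matrix.isUnit_det_of_left_inverse (hA.P_mul_h hp)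

theorem Pc_succ_succ (hA : D.IsAdapted u x U) (hp : p ∈ U) (A B : Fin k) :
    D.Pc (adaptedCoords u x) A.succ B.succ p = D.hInv u x A B p := by
  rw [hInv, Matrix.inv_eq_left_inv (hA.P_mul_h hp), Matrix.of_apply]

theorem hInv_symm (D : HypersurfaceData I H) (u : H → ℝ) (x : Fin k → H → ℝ) (A B : Fin k) :
    D.hInv u x A B = D.hInv u x B A := by
  funext p
  have hT : (D.h u x p).transpose = D.h u x p := by
    ext A B
    simp only [Matrix.transpose_apply, h, Matrix.of_apply]
    rw [D.γc_symm]
  have := congrFun (congrFun (Matrix.transpose_nonsing_inv (D.h u x p)) B) A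
  rw [hT] at this
  exact this

theorem sum_hInv_h (hA : D.IsAdapted u x U) (hp : p ∈ U) (A C : Fin k) :
    ∑ B, D.hInv u x A B p * D.γc (adaptedCoords u x) B.succ C.succ p = if A = C then 1 else 0 := by
  have := congrFun (congrFun (Matrix.nonsing_inv_mul _ (hA.isUnit_det_h hp)) A) C
  rw [Matrix.mul_apply, Matrix.one_apply] at this
  exact this

theorem sum_h_hInv (hA : D.IsAdapted u x U) (hp : p ∈ U) (A C : Fin k) :
    ∑ B, D.γc (adaptedCoords u x) A.succ B.succ p * D.hInv u x B C p = if A = C then 1 else 0 := by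
  have := congrFun (congrFun (Matrix.mul_nonsing_inv _ (hA.isUnit_det_h hp)) A) C
  rw [Matrix.mul_apply, Matrix.one_apply] at this
  exact this

theorem Pc_succ_zero (hA : D.IsAdapted u x U) (hp : p ∈ U) (A : Fin k) :
    D.Pc (adaptedCoords u x) A.succ 0 p = -(D.lam u p * D.ℓSharp u x A p) := by
  have h1 := hA.sum_Pc_ℓc hp A.succ
  rw [Fin.sum_univ_succ, hA.nc_succ hp] at h1
  simp only [hA.Pc_succ_succ hp] at h1
  change _ + D.ℓSharp u x A p + _ = 0 at h1
  linear_combination D.lam u p * h1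
    - D.Pc (adaptedCoords u x) A.succ 0 p * hA.lam_mul_ℓc_zero hp

theorem Pc_zero_succ (hA : D.IsAdapted u x U) (hp : p ∈ U) (A : Fin k) :
    D.Pc (adaptedCoords u x) 0 A.succ p = -(D.lam u p * D.ℓSharp u x A p) := by
  have h1 : ∀ C : Fin k, ∑ B : Fin k, D.Pc (adaptedCoords u x) 0 B.succ p
      * D.γc (adaptedCoords u x) B.succ C.succ p
      = -(D.lam u p * D.ℓc (adaptedCoords u x) C.succ p) := by
    intro C
    have := hA.sum_Pc_γc hp 0 C.succ
    rw [Fin.sum_univ_succ, hA.γc_zero hp, nc_zero, if_neg (Fin.succ_ne_zero C).symm] at this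
    linear_combination this
  -- The row `P^{0B}` is recovered from `P^{0B} h_{BC} = -λ ℓ_C` by inverting `h`; symmetry of `P`
  -- is not needed.
  have h2 : ∑ C, (∑ B : Fin k, D.Pc (adaptedCoords u x) 0 B.succ p
      * D.γc (adaptedCoords u x) B.succ C.succ p) * D.hInv u x C A p
      = D.Pc (adaptedCoords u x) 0 A.succ p := by
    simp only [Finset.sum_mul]
    rw [Finset.sum_comm]
    simp only [mul_assoc, ← Finset.mul_sum, hA.sum_h_hInv hp]
    simp
  rw [← h2]
  simp only [h1, ℓSharp, ℓLeaf, Finset.mul_sum, ← Finset.sum_neg_distrib]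
  refine Finset.sum_congr rfl fun C _ => ?_
  rw [hInv_symm D u x C A]
  ring

theorem Pc_zero_zero (hA : D.IsAdapted u x U) (hp : p ∈ U) :
    D.Pc (adaptedCoords u x) 0 0 p
      = D.lam u p ^ 2 * (∑ A, D.ℓSharp u x A p * D.ℓLeaf u x A p - D.ℓ₂ p) := by
  have h1 := hA.sum_Pc_ℓc hp 0
  rw [Fin.sum_univ_succ, nc_zero] at h1
  simp only [hA.Pc_zero_succ hp, neg_mul, mul_assoc, Finset.sum_neg_distrib,
    ← Finset.mul_sum] at h1
  change _ + -(_ * ∑ A, D.ℓSharp u x A p * D.ℓLeaf u x A p) + _ = 0 at h1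
  linear_combination D.lam u p * h1
    - D.Pc (adaptedCoords u x) 0 0 p * hA.lam_mul_ℓc_zero hp

/-! ### Smoothness of components and rules for partial derivatives. -/

theorem pd_smooth (hA : D.IsAdapted u x U) (a : Fin (k + 1)) {f : H → ℝ}
    (hf : ContMDiffOn I 𝓘(ℝ, ℝ) ∞ f U) :
    ContMDiffOn I 𝓘(ℝ, ℝ) ∞ (pd I (adaptedCoords u x) a f) U :=
  contMDiffOn_pd hA.isOpen hA.coords_smooth (fun _ hp => hA.coords_linearIndependent hp) a hf

theorem mdiff (hA : D.IsAdapted u x U) {f : H → ℝ} (hf : ContMDiffOn I 𝓘(ℝ, ℝ) ∞ f U)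
    (hp : p ∈ U) : MDifferentiableAt I 𝓘(ℝ, ℝ) f p :=
  (hf.contMDiffAt (hA.isOpen.mem_nhds hp)).mdifferentiableAt (by simp)

theorem coordVec_smooth (hA : D.IsAdapted u x U) (a : Fin (k + 1)) :
    ContMDiffOn I (I.prod 𝓘(ℝ, EuclideanSpace ℝ (Fin (k + 1)))) ∞
      (fun p => (⟨p, coordVec I (adaptedCoords u x) p a⟩ : TangentBundle I H)) U :=
  contMDiffOn_coordVec hA.isOpen hA.coords_smooth (fun _ hp => hA.coords_linearIndependent hp) a

theorem γc_smooth (hA : D.IsAdapted u x U) (a b : Fin (k + 1)) :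
    ContMDiffOn I 𝓘(ℝ, ℝ) ∞ (D.γc (adaptedCoords u x) a b) U :=
  contMDiffOn_bilin_apply D.γ_smooth (hA.coordVec_smooth a) (hA.coordVec_smooth b)

theorem Yc_smooth (hA : D.IsAdapted u x U) (a b : Fin (k + 1)) :
    ContMDiffOn I 𝓘(ℝ, ℝ) ∞ (D.Yc (adaptedCoords u x) a b) U :=
  contMDiffOn_bilin_apply D.Y_smooth (hA.coordVec_smooth a) (hA.coordVec_smooth b)

theorem ℓc_smooth (hA : D.IsAdapted u x U) (a : Fin (k + 1)) :
    ContMDiffOn I 𝓘(ℝ, ℝ) ∞ (D.ℓc (adaptedCoords u x) a) U :=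
  contMDiffOn_covector_apply D.ℓ_smooth (hA.coordVec_smooth a)

/-- The vector `n` comes from a pointwise inversion, so its smoothness is not given; here it follows
from `λ = 1/ℓ_0`. Smoothness of `P` is likewise read off its explicit components. -/
theorem lam_smooth (hA : D.IsAdapted u x U) : ContMDiffOn I 𝓘(ℝ, ℝ) ∞ (D.lam u) U := by
  refine ((hA.ℓc_smooth 0).inv₀ fun p hp h0 => ?_).congr fun p hp => ?_
  · simpa [h0] using hA.lam_mul_ℓc_zero hp
  · exact eq_inv_of_mul_eq_one_left (hA.lam_mul_ℓc_zero hp)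

theorem nDeriv_smooth (hA : D.IsAdapted u x U) {f : H → ℝ}
    (hf : ContMDiffOn I 𝓘(ℝ, ℝ) ∞ f U) : ContMDiffOn I 𝓘(ℝ, ℝ) ∞ (D.nDeriv f) U :=
  (hA.lam_smooth.mul (hA.pd_smooth 0 hf)).congr fun _ hp => hA.nDeriv_eq hp f

theorem nc_smooth (hA : D.IsAdapted u x U) (a : Fin (k + 1)) :
    ContMDiffOn I 𝓘(ℝ, ℝ) ∞ (D.nc (adaptedCoords u x) a) U :=
  hA.nDeriv_smooth (hA.coords_smooth a)

theorem hInv_smooth (hA : D.IsAdapted u x U) (A B : Fin k) :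
    ContMDiffOn I 𝓘(ℝ, ℝ) ∞ (D.hInv u x A B) U := by
  have hs : ∀ A B, ContMDiffOn I 𝓘(ℝ, ℝ) ∞ (fun p => D.h u x p A B) U := fun A B =>
    hA.γc_smooth A.succ B.succ
  exact contMDiffOn_matrix_inv hs (fun _ hp => (hA.isUnit_det_h hp).ne_zero) A B

theorem ℓSharp_smooth (hA : D.IsAdapted u x U) (A : Fin k) :
    ContMDiffOn I 𝓘(ℝ, ℝ) ∞ (D.ℓSharp u x A) U :=
  contMDiffOn_finsetSum fun B _ => (hA.hInv_smooth A B).mul (hA.ℓc_smooth B.succ)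

theorem Pc_smooth (hA : D.IsAdapted u x U) (a b : Fin (k + 1)) :
    ContMDiffOn I 𝓘(ℝ, ℝ) ∞ (D.Pc (adaptedCoords u x) a b) U := by
  refine Fin.cases ?_ (fun A => ?_) a <;> refine Fin.cases ?_ (fun B => ?_) b
  · exact ((hA.lam_smooth.pow 2).mul ((contMDiffOn_finsetSum fun A _ =>
      (hA.ℓSharp_smooth A).mul (hA.ℓc_smooth A.succ)).sub D.ℓ₂_smooth.contMDiffOn)).congr
      fun p hp => hA.Pc_zero_zero hp
  · exact (hA.lam_smooth.mul (hA.ℓSharp_smooth B)).neg.congr fun p hp => hA.Pc_zero_succ hp B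
  · exact (hA.lam_smooth.mul (hA.ℓSharp_smooth A)).neg.congr fun p hp => hA.Pc_succ_zero hp A
  · exact (hA.hInv_smooth A B).congr fun p hp => hA.Pc_succ_succ hp A B

theorem Γ_smooth (hA : D.IsAdapted u x U) (c a b : Fin (k + 1)) :
    ContMDiffOn I 𝓘(ℝ, ℝ) ∞ (D.Γ (adaptedCoords u x) c a b) U :=
  (contMDiffOn_const.mul (contMDiffOn_finsetSum fun d _ => (hA.Pc_smooth c d).mul
    (((hA.pd_smooth a (hA.γc_smooth b d)).add (hA.pd_smooth b (hA.γc_smooth a d))).sub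
      (hA.pd_smooth d (hA.γc_smooth a b))))).add
  ((hA.nc_smooth c).mul ((contMDiffOn_const.mul ((hA.pd_smooth a (hA.ℓc_smooth b)).add
    (hA.pd_smooth b (hA.ℓc_smooth a)))).sub (hA.Yc_smooth a b)))

theorem lieN1_smooth (hA : D.IsAdapted u x U) {α : Fin (k + 1) → H → ℝ}
    (hα : ∀ a, ContMDiffOn I 𝓘(ℝ, ℝ) ∞ (α a) U) (a : Fin (k + 1)) :
    ContMDiffOn I 𝓘(ℝ, ℝ) ∞ (D.lieN1 (adaptedCoords u x) α a) U :=
  contMDiffOn_finsetSum fun b _ => ((hA.nc_smooth b).mul (hA.pd_smooth b (hα a))).add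
    ((hα b).mul (hA.pd_smooth a (hA.nc_smooth b)))

theorem pd_congr (hA : D.IsAdapted u x U) (hp : p ∈ U) {f g : H → ℝ}
    (h : ∀ q ∈ U, f q = g q) (a : Fin (k + 1)) :
    pd I (adaptedCoords u x) a f p = pd I (adaptedCoords u x) a g p := by
  rw [pd, pd, differential_congr hA.isOpen hp h]

theorem pd_eq_zero (hA : D.IsAdapted u x U) (hp : p ∈ U) {f : H → ℝ}
    (h : ∀ q ∈ U, f q = 0) (a : Fin (k + 1)) : pd I (adaptedCoords u x) a f p = 0 := by
  rw [hA.pd_congr hp h, pd, differential_const]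
  rfl

theorem pd_add (hA : D.IsAdapted u x U) (hp : p ∈ U) {f g : H → ℝ}
    (hf : ContMDiffOn I 𝓘(ℝ, ℝ) ∞ f U) (hg : ContMDiffOn I 𝓘(ℝ, ℝ) ∞ g U) (a : Fin (k + 1)) :
    pd I (adaptedCoords u x) a (fun q => f q + g q) p
      = pd I (adaptedCoords u x) a f p + pd I (adaptedCoords u x) a g p := by
  rw [pd, differential_add (hA.mdiff hf hp) (hA.mdiff hg hp)]
  rfl

theorem pd_sub (hA : D.IsAdapted u x U) (hp : p ∈ U) {f g : H → ℝ}
    (hf : ContMDiffOn I 𝓘(ℝ, ℝ) ∞ f U) (hg : ContMDiffOn I 𝓘(ℝ, ℝ) ∞ g U) (a : Fin (k + 1)) :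
    pd I (adaptedCoords u x) a (fun q => f q - g q) p
      = pd I (adaptedCoords u x) a f p - pd I (adaptedCoords u x) a g p := by
  rw [pd, differential_sub (hA.mdiff hf hp) (hA.mdiff hg hp)]
  rfl

theorem pd_mul (hA : D.IsAdapted u x U) (hp : p ∈ U) {f g : H → ℝ}
    (hf : ContMDiffOn I 𝓘(ℝ, ℝ) ∞ f U) (hg : ContMDiffOn I 𝓘(ℝ, ℝ) ∞ g U) (a : Fin (k + 1)) :
    pd I (adaptedCoords u x) a (fun q => f q * g q) p
      = f p * pd I (adaptedCoords u x) a g p + g p * pd I (adaptedCoords u x) a f p := by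
  rw [pd, differential_mul (hA.mdiff hf hp) (hA.mdiff hg hp)]
  rfl

theorem pd_const_mul (hA : D.IsAdapted u x U) (hp : p ∈ U) (c : ℝ) {f : H → ℝ}
    (hf : ContMDiffOn I 𝓘(ℝ, ℝ) ∞ f U) (a : Fin (k + 1)) :
    pd I (adaptedCoords u x) a (fun q => c * f q) p = c * pd I (adaptedCoords u x) a f p := by
  have : pd I (adaptedCoords u x) a (fun _ => c) p = 0 := by
    rw [pd, differential_const]
    rfl
  rw [hA.pd_mul hp contMDiffOn_const hf, this, mul_zero, add_zero]

theorem pd_sum (hA : D.IsAdapted u x U) (hp : p ∈ U) {ι : Type*} (s : Finset ι) {f : ι → H → ℝ}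
    (hf : ∀ i, ContMDiffOn I 𝓘(ℝ, ℝ) ∞ (f i) U) (a : Fin (k + 1)) :
    pd I (adaptedCoords u x) a (fun q => ∑ i ∈ s, f i q) p
      = ∑ i ∈ s, pd I (adaptedCoords u x) a (f i) p := by
  rw [pd, differential_sum s fun i _ => hA.mdiff (hf i) hp]
  simp [pd]

/-! ### The tensor `K` and the connection coefficients with an index along `n`. -/

theorem n₂_eq (hA : D.IsAdapted u x U) : D.n₂ = fun _ => 0 :=
  funext fun p => (hA.isCharacteristic.n_spec p).2.2

/-- Vanishing of `n⁽²⁾` removes both `Y` and `dn⁽²⁾`. In `𝓛_n γ` the derivatives of `λ` multiply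
`γ_{0a} = 0` and those of `n^A = 0` vanish. -/
theorem K_eq (hA : D.IsAdapted u x U) (hp : p ∈ U) (a b : Fin (k + 1)) :
    D.K (adaptedCoords u x) a b p
      = 1 / 2 * (D.lam u p * pd I (adaptedCoords u x) 0 (D.γc (adaptedCoords u x) a b) p) := by
  have h0 : ∀ c, pd I (adaptedCoords u x) c D.n₂ p = 0 := fun c => by
    rw [hA.n₂_eq, pd, differential_const]
    rfl
  have h1 : ∀ c (C : Fin k), pd I (adaptedCoords u x) c (D.nc (adaptedCoords u x) C.succ) p = 0 :=
    fun c C => hA.pd_eq_zero hp (fun q hq => hA.nc_succ hq C) c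
  rw [K, h0, h0, hA.n₂_eq, lieN2, Fin.sum_univ_succ]
  simp only [hA.nc_succ hp, h1, hA.γc_zero hp, hA.γc_zero' hp, nc_zero]
  simp

theorem K_symm (hA : D.IsAdapted u x U) (hp : p ∈ U) (a b : Fin (k + 1)) :
    D.K (adaptedCoords u x) a b p = D.K (adaptedCoords u x) b a p := by
  rw [hA.K_eq hp, hA.K_eq hp, D.γc_symm]

theorem K_zero (hA : D.IsAdapted u x U) (hp : p ∈ U) (a : Fin (k + 1)) :
    D.K (adaptedCoords u x) 0 a p = 0 := by
  rw [hA.K_eq hp, hA.pd_eq_zero hp fun q hq => hA.γc_zero hq a]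
  simp

theorem K_zero' (hA : D.IsAdapted u x U) (hp : p ∈ U) (a : Fin (k + 1)) :
    D.K (adaptedCoords u x) a 0 p = 0 := by
  rw [hA.K_symm hp, hA.K_zero hp]

theorem K_smooth (hA : D.IsAdapted u x U) (a b : Fin (k + 1)) :
    ContMDiffOn I 𝓘(ℝ, ℝ) ∞ (D.K (adaptedCoords u x) a b) U :=
  (contMDiffOn_const.mul (hA.lam_smooth.mul (hA.pd_smooth 0 (hA.γc_smooth a b)))).congr
    fun _ hp => hA.K_eq hp a b

theorem Γ_symm (D : HypersurfaceData I H) (y : Fin (k + 1) → H → ℝ) (c a b : Fin (k + 1)) :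
    D.Γ y c a b = D.Γ y c b a := by
  funext p
  simp only [Γ, D.γc_symm y b a, D.Yc_symm y b a]
  simp only [add_comm (pd I y b _ p)]

/-- `Γ̄^F_{c0} = λ⁻¹ χ_c^F`. -/
theorem lam_mul_Γ_succ (hA : D.IsAdapted u x U) (hp : p ∈ U) (F : Fin k) (c : Fin (k + 1)) :
    D.lam u p * D.Γ (adaptedCoords u x) F.succ c 0 p
      = ∑ E, D.hInv u x F E p * D.K (adaptedCoords u x) c E.succ p := by
  have h1 : ∀ a b, pd I (adaptedCoords u x) a (D.γc (adaptedCoords u x) 0 b) p = 0 :=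
    fun a b => hA.pd_eq_zero hp (fun q hq => hA.γc_zero hq b) a
  have h2 : ∀ a b, pd I (adaptedCoords u x) a (D.γc (adaptedCoords u x) b 0) p = 0 :=
    fun a b => hA.pd_eq_zero hp (fun q hq => hA.γc_zero' hq b) a
  rw [Γ, hA.nc_succ hp, Fin.sum_univ_succ]
  simp only [h1, h2, hA.Pc_succ_succ hp, hA.K_eq hp]
  simp only [Finset.mul_sum, zero_mul, add_zero, zero_add, sub_zero, mul_zero]
  exact Finset.sum_congr rfl fun _ _ => by ring

theorem Γ_succ_zero_zero (hA : D.IsAdapted u x U) (hp : p ∈ U) (F : Fin k) :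
    D.Γ (adaptedCoords u x) F.succ 0 0 p = 0 := by
  have := hA.lam_mul_Γ_succ hp F 0
  simp only [hA.K_zero hp, mul_zero, Finset.sum_const_zero] at this
  exact (mul_eq_zero.1 this).resolve_left (hA.lam_ne_zero p)

/-- `λ Γ̄^0_{00} = - ∂_0 λ - 2 ω`. -/
theorem lam_mul_Γ_zero (hA : D.IsAdapted u x U) (hp : p ∈ U) :
    D.lam u p * D.Γ (adaptedCoords u x) 0 0 0 p
      = -pd I (adaptedCoords u x) 0 (D.lam u) p - 2 * D.omega p := by
  have h1 : ∀ a b, pd I (adaptedCoords u x) a (D.γc (adaptedCoords u x) 0 b) p = 0 :=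
    fun a b => hA.pd_eq_zero hp (fun q hq => hA.γc_zero hq b) a
  -- Differentiating `λ ℓ_0 = 1` trades `∂_0 ℓ_0` for `∂_0 λ`.
  have h2 := hA.pd_mul hp hA.lam_smooth (hA.ℓc_smooth 0) 0
  rw [hA.pd_congr hp (g := fun _ => 1) (fun q hq => hA.lam_mul_ℓc_zero hq), pd,
    differential_const] at h2
  change 0 = _ at h2
  rw [Γ, nc_zero, hA.two_mul_omega hp]
  simp only [h1]
  simp only [add_zero, sub_zero, mul_zero, Finset.sum_const_zero, zero_add]
  linear_combination -D.lam u p * h2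
    - pd I (adaptedCoords u x) 0 (D.lam u) p * hA.lam_mul_ℓc_zero hp

end IsAdapted

/-- The components of the difference of the tensors `Y` of two data sets. -/
noncomputable def YDiff (D₁ D₂ : HypersurfaceData I H) (y : Fin (k + 1) → H → ℝ) (a b : Fin (k + 1)) : H → ℝ :=
  fun p => D₁.Yc y a b p - D₂.Yc y a b p

theorem YDiff_symm (D₁ D₂ : HypersurfaceData I H) (y : Fin (k + 1) → H → ℝ) (a b : Fin (k + 1)) :
    YDiff D₁ D₂ y a b = YDiff D₁ D₂ y b a := by
  funext p
  rw [YDiff, YDiff, D₁.Yc_symm, D₂.Yc_symm]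

/-- Two data sets with the same metric data and the same `ω`, with adapted coordinates. -/
structure IsAdaptedPair (D₁ D₂ : HypersurfaceData I H) (u : H → ℝ) (x : Fin k → H → ℝ)
    (U : Set H) : Prop where
  left : D₁.IsAdapted u x U
  right : D₂.IsAdapted u x U
  metric_eq : D₁.toMetricHypersurfaceData = D₂.toMetricHypersurfaceData
  omega_eq : ∀ p ∈ U, D₁.omega p = D₂.omega p

/-! ### Quantities common to two data sets with the same metric data. -/

namespace IsAdaptedPair

theorem γc_eq (hP : IsAdaptedPair D₁ D₂ u x U) (y : Fin (k + 1) → H → ℝ) :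
    D₁.γc y = D₂.γc y := by
  unfold γc; rw [hP.metric_eq]

theorem ℓc_eq (hP : IsAdaptedPair D₁ D₂ u x U) (y : Fin (k + 1) → H → ℝ) :
    D₁.ℓc y = D₂.ℓc y := by
  unfold ℓc; rw [hP.metric_eq]

theorem ℓ₂_eq (hP : IsAdaptedPair D₁ D₂ u x U) : D₁.ℓ₂ = D₂.ℓ₂ := by
  rw [hP.metric_eq]

theorem nDeriv_eq (hP : IsAdaptedPair D₁ D₂ u x U) : D₁.nDeriv = D₂.nDeriv := by
  rw [hP.metric_eq]

theorem lam_eq (hP : IsAdaptedPair D₁ D₂ u x U) : D₁.lam = D₂.lam := by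
  unfold lam; rw [hP.metric_eq]

theorem nc_eq (hP : IsAdaptedPair D₁ D₂ u x U) : D₁.nc = D₂.nc := by
  unfold nc; rw [hP.metric_eq]

theorem Pc_eq (hP : IsAdaptedPair D₁ D₂ u x U) : D₁.Pc = D₂.Pc := by
  unfold Pc; rw [hP.metric_eq]

theorem F_eq (hP : IsAdaptedPair D₁ D₂ u x U) : D₁.F = D₂.F := by
  unfold F ℓc; rw [hP.metric_eq]

theorem lieN1_eq (hP : IsAdaptedPair D₁ D₂ u x U) : D₁.lieN1 = D₂.lieN1 := by
  unfold lieN1; rw [hP.nc_eq]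

theorem K_eq (hP : IsAdaptedPair D₁ D₂ u x U) : D₁.K = D₂.K := by
  unfold K lieN2
  rw [hP.left.n₂_eq, hP.right.n₂_eq, hP.nc_eq]
  funext y a b p
  rw [hP.γc_eq, hP.ℓc_eq]
  simp only [zero_mul]

theorem h_eq (hP : IsAdaptedPair D₁ D₂ u x U) : D₁.h = D₂.h := by
  unfold h γc; rw [hP.metric_eq]

theorem hInv_eq (hP : IsAdaptedPair D₁ D₂ u x U) : D₁.hInv = D₂.hInv := by
  unfold hInv; rw [hP.h_eq]

theorem χ_eq (hP : IsAdaptedPair D₁ D₂ u x U) : D₁.χ = D₂.χ := by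
  unfold χ; rw [hP.K_eq]

theorem tr_eq (hP : IsAdaptedPair D₁ D₂ u x U) : D₁.tr = D₂.tr := by
  unfold tr; rw [hP.hInv_eq]

theorem ℓLeaf_eq (hP : IsAdaptedPair D₁ D₂ u x U) : D₁.ℓLeaf = D₂.ℓLeaf := by
  unfold ℓLeaf ℓc; rw [hP.metric_eq]

theorem ℓPar_eq (hP : IsAdaptedPair D₁ D₂ u x U) : D₁.ℓPar = D₂.ℓPar := by
  unfold ℓPar; rw [hP.lam_eq, hP.metric_eq]

theorem ℓSharp_eq (hP : IsAdaptedPair D₁ D₂ u x U) : D₁.ℓSharp = D₂.ℓSharp := by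
  unfold ℓSharp; rw [hP.hInv_eq, hP.ℓLeaf_eq]

theorem ℓSharp₂_eq (hP : IsAdaptedPair D₁ D₂ u x U) : D₁.ℓSharp₂ = D₂.ℓSharp₂ := by
  unfold ℓSharp₂; rw [hP.ℓSharp_eq, hP.h_eq]

theorem χSharpℓ_eq (hP : IsAdaptedPair D₁ D₂ u x U) : D₁.χSharpℓ = D₂.χSharpℓ := by
  unfold χSharpℓ; rw [hP.ℓSharp_eq, hP.hInv_eq, hP.χ_eq]

theorem ΓLeaf_eq (hP : IsAdaptedPair D₁ D₂ u x U) : D₁.ΓLeaf = D₂.ΓLeaf := by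
  unfold ΓLeaf; rw [hP.hInv_eq, hP.h_eq]

theorem boxLeaf_eq (hP : IsAdaptedPair D₁ D₂ u x U) : D₁.boxLeaf = D₂.boxLeaf := by
  unfold boxLeaf; rw [hP.hInv_eq, hP.ΓLeaf_eq]

theorem divℓ_eq (hP : IsAdaptedPair D₁ D₂ u x U) : D₁.divℓ = D₂.divℓ := by
  unfold divℓ; rw [hP.hInv_eq, hP.ΓLeaf_eq, hP.ℓLeaf_eq]

theorem lieℓ_eq (hP : IsAdaptedPair D₁ D₂ u x U) : D₁.lieℓ = D₂.lieℓ := by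
  unfold lieℓ ℓc; rw [hP.lieN1_eq, hP.metric_eq]

theorem gradLeaf_eq (hP : IsAdaptedPair D₁ D₂ u x U) : D₁.gradLeaf = D₂.gradLeaf := by
  unfold gradLeaf; rw [hP.hInv_eq]

theorem Φ_eq (hP : IsAdaptedPair D₁ D₂ u x U) (hp : p ∈ U) : D₁.Φ u x p = D₂.Φ u x p := by
  unfold Φ
  rw [hP.ℓ₂_eq, hP.ℓSharp₂_eq, hP.omega_eq p hp, hP.tr_eq, hP.χ_eq, hP.nDeriv_eq, hP.lam_eq,
    hP.divℓ_eq, hP.lieℓ_eq, hP.ℓSharp_eq]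

/-! ### Change of the connection, the curvature and the tensors `A`, `B` under `δY`. -/

theorem YDiff_smooth (hP : IsAdaptedPair D₁ D₂ u x U) (a b : Fin (k + 1)) :
    ContMDiffOn I 𝓘(ℝ, ℝ) ∞ (YDiff D₁ D₂ (adaptedCoords u x) a b) U :=
  (hP.left.Yc_smooth a b).sub (hP.right.Yc_smooth a b)

theorem lam_mul_YDiff_smooth (hP : IsAdaptedPair D₁ D₂ u x U) (a b : Fin (k + 1)) :
    ContMDiffOn I 𝓘(ℝ, ℝ) ∞
      (fun q => D₂.lam u q * YDiff D₁ D₂ (adaptedCoords u x) a b q) U :=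
  hP.right.lam_smooth.mul (hP.YDiff_smooth a b)

/-- This is the whole content of equality of `ω`, since `2ω = λ² Y_{00}` and `λ ≠ 0`. -/
theorem YDiff_zero_zero (hP : IsAdaptedPair D₁ D₂ u x U) (hp : p ∈ U) :
    YDiff D₁ D₂ (adaptedCoords u x) 0 0 p = 0 := by
  have h1 := hP.left.two_mul_omega hp
  rw [hP.omega_eq p hp, hP.right.two_mul_omega hp, hP.lam_eq] at h1
  rw [YDiff, sub_eq_zero]
  exact (mul_left_cancel₀ (pow_ne_zero 2 (hP.right.lam_ne_zero p)) h1).symm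

/-- In the Koszul formula `Y` occurs only in the term along `n`. In adapted coordinates only the
upper index `0` is therefore affected. -/
theorem Γ_diff (hP : IsAdaptedPair D₁ D₂ u x U) (y : Fin (k + 1) → H → ℝ)
    (c a b : Fin (k + 1)) (p : H) :
    D₁.Γ y c a b p = D₂.Γ y c a b p - D₂.nc y c p * YDiff D₁ D₂ y a b p := by
  unfold Γ YDiff
  rw [hP.nc_eq, hP.Pc_eq, hP.γc_eq, hP.ℓc_eq]
  ring

theorem Γ_succ_eq (hP : IsAdaptedPair D₁ D₂ u x U) (hp : p ∈ U) (F : Fin k)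
    (a b : Fin (k + 1)) :
    D₁.Γ (adaptedCoords u x) F.succ a b p = D₂.Γ (adaptedCoords u x) F.succ a b p := by
  rw [hP.Γ_diff, hP.right.nc_succ hp, zero_mul, sub_zero]

theorem Γ_zero_diff (hP : IsAdaptedPair D₁ D₂ u x U) (a b : Fin (k + 1)) (p : H) :
    D₁.Γ (adaptedCoords u x) 0 a b p = D₂.Γ (adaptedCoords u x) 0 a b p
      - D₂.lam u p * YDiff D₁ D₂ (adaptedCoords u x) a b p := hP.Γ_diff _ 0 a b p

/-- The coefficients `Γ̄^F_{ab}` are common to both data sets, so there are no derivatives of `δY`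
and no quadratic terms. Only the summand `e = 0` changes, with factor `λ Γ̄^F_{c0} = χ_c^F`. -/
theorem curv_succ_diff (hP : IsAdaptedPair D₁ D₂ u x U) (hp : p ∈ U) (F : Fin k)
    (b c d : Fin (k + 1)) :
    D₁.curv (adaptedCoords u x) F.succ b c d p = D₂.curv (adaptedCoords u x) F.succ b c d p
      - ∑ E, D₂.hInv u x F E p * (D₂.K (adaptedCoords u x) c E.succ p
          * YDiff D₁ D₂ (adaptedCoords u x) d b p
        - D₂.K (adaptedCoords u x) d E.succ p * YDiff D₁ D₂ (adaptedCoords u x) c b p) := by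
  have h1 := hP.right.lam_mul_Γ_succ hp F c
  have h2 := hP.right.lam_mul_Γ_succ hp F d
  have h3 : ∀ e a b, pd I (adaptedCoords u x) e (D₁.Γ (adaptedCoords u x) F.succ a b) p
      = pd I (adaptedCoords u x) e (D₂.Γ (adaptedCoords u x) F.succ a b) p := fun e a b =>
    hP.left.pd_congr hp (fun q hq => hP.Γ_succ_eq hq F a b) e
  have h4 : ∑ E, D₂.hInv u x F E p * (D₂.K (adaptedCoords u x) c E.succ p
          * YDiff D₁ D₂ (adaptedCoords u x) d b p
        - D₂.K (adaptedCoords u x) d E.succ p * YDiff D₁ D₂ (adaptedCoords u x) c b p)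
      = (∑ E, D₂.hInv u x F E p * D₂.K (adaptedCoords u x) c E.succ p)
          * YDiff D₁ D₂ (adaptedCoords u x) d b p
        - (∑ E, D₂.hInv u x F E p * D₂.K (adaptedCoords u x) d E.succ p)
          * YDiff D₁ D₂ (adaptedCoords u x) c b p := by
    rw [Finset.sum_mul, Finset.sum_mul, ← Finset.sum_sub_distrib]
    exact Finset.sum_congr rfl fun _ _ => by ring
  rw [h4, ← h1, ← h2, curv, curv, Fin.sum_univ_succ, Fin.sum_univ_succ]
  simp only [h3, hP.Γ_succ_eq hp, hP.Γ_zero_diff]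
  ring

/-- `γ_{af} δR̄^f_{bcd} = - K_{ac} δY_{db} + K_{ad} δY_{cb}`. -/
theorem sum_γc_curv_diff (hP : IsAdaptedPair D₁ D₂ u x U) (hp : p ∈ U)
    (a b c d : Fin (k + 1)) :
    ∑ f, D₂.γc (adaptedCoords u x) a f p * D₁.curv (adaptedCoords u x) f b c d p
      = ∑ f, D₂.γc (adaptedCoords u x) a f p * D₂.curv (adaptedCoords u x) f b c d p
        - (D₂.K (adaptedCoords u x) a c p * YDiff D₁ D₂ (adaptedCoords u x) d b p
          - D₂.K (adaptedCoords u x) a d p * YDiff D₁ D₂ (adaptedCoords u x) c b p) := by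
  rw [Fin.sum_univ_succ, Fin.sum_univ_succ]
  simp only [hP.right.γc_zero' hp, hP.curv_succ_diff hp, mul_sub, Finset.sum_sub_distrib]
  -- Lowering the index: for `a` tangential `h h⁻¹ = 1`, and for `a = 0` both sides vanish because
  -- `γ_{0F} = 0` and `K_{0c} = 0`.
  have key : ∀ (c : Fin (k + 1)) (z : ℝ), ∑ F : Fin k, D₂.γc (adaptedCoords u x) a F.succ p
      * ∑ E, D₂.hInv u x F E p * (D₂.K (adaptedCoords u x) c E.succ p * z)
      = D₂.K (adaptedCoords u x) a c p * z := by
    intro c z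
    refine Fin.cases ?_ (fun A => ?_) a
    · simp [hP.right.γc_zero hp, hP.right.K_zero hp]
    · simp only [Finset.mul_sum]
      rw [Finset.sum_comm]
      simp only [← mul_assoc, ← Finset.sum_mul, hP.right.sum_h_hInv hp]
      simp [hP.right.K_symm hp c A.succ]
  rw [key, key]
  ring

/-- The change feeds only on components with a slot equal to `0`; hence `∇̄K` is the same for both
data sets. -/
theorem cov2_diff (hP : IsAdaptedPair D₁ D₂ u x U) (hp : p ∈ U)
    (T : Fin (k + 1) → Fin (k + 1) → H → ℝ) (d a b : Fin (k + 1)) :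
    D₁.cov2 (adaptedCoords u x) T d a b p = D₂.cov2 (adaptedCoords u x) T d a b p
      + D₂.lam u p * (YDiff D₁ D₂ (adaptedCoords u x) d a p * T 0 b p
        + YDiff D₁ D₂ (adaptedCoords u x) d b p * T a 0 p) := by
  rw [cov2, cov2, Fin.sum_univ_succ, Fin.sum_univ_succ]
  simp only [hP.Γ_succ_eq hp, hP.Γ_zero_diff]
  ring

theorem cov3_diff (hP : IsAdaptedPair D₁ D₂ u x U) (hp : p ∈ U)
    (T : Fin (k + 1) → Fin (k + 1) → Fin (k + 1) → H → ℝ) (d a b c : Fin (k + 1)) :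
    D₁.cov3 (adaptedCoords u x) T d a b c p = D₂.cov3 (adaptedCoords u x) T d a b c p
      + D₂.lam u p * (YDiff D₁ D₂ (adaptedCoords u x) d a p * T 0 b c p
        + YDiff D₁ D₂ (adaptedCoords u x) d b p * T a 0 c p
        + YDiff D₁ D₂ (adaptedCoords u x) d c p * T a b 0 p) := by
  rw [cov3, cov3, Fin.sum_univ_succ, Fin.sum_univ_succ]
  simp only [hP.Γ_succ_eq hp, hP.Γ_zero_diff]
  ring

/-- The first two correction terms are the lowered curvature. The last two come from `∇̄(K ⊗ ℓ)`,
where only the slot of `ℓ` contributes, with coefficient `λ ℓ_0 = 1`. -/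
theorem tensorB_diff (hP : IsAdaptedPair D₁ D₂ u x U) (hp : p ∈ U) (a b c d : Fin (k + 1)) :
    D₁.tensorB (adaptedCoords u x) a b c d p = D₂.tensorB (adaptedCoords u x) a b c d p
      - D₂.K (adaptedCoords u x) a c p * YDiff D₁ D₂ (adaptedCoords u x) d b p
      + D₂.K (adaptedCoords u x) a d p * YDiff D₁ D₂ (adaptedCoords u x) c b p
      + YDiff D₁ D₂ (adaptedCoords u x) d a p * D₂.K (adaptedCoords u x) c b p
      - YDiff D₁ D₂ (adaptedCoords u x) c a p * D₂.K (adaptedCoords u x) d b p := by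
  have hKℓ : D₁.Kℓ (adaptedCoords u x) = D₂.Kℓ (adaptedCoords u x) := by
    unfold Kℓ; rw [hP.K_eq, hP.ℓc_eq]
  have h1 := hP.right.lam_mul_ℓc_zero hp
  rw [tensorB, tensorB, hP.γc_eq, hP.sum_γc_curv_diff hp, hKℓ, hP.cov3_diff hp, hP.cov3_diff hp,
    hP.K_eq, hP.ℓ₂_eq, YDiff_symm D₁ D₂ _ c d]
  simp only [Kℓ, hP.right.K_zero hp, hP.right.K_zero' hp]
  linear_combination (YDiff D₁ D₂ (adaptedCoords u x) d a p * D₂.K (adaptedCoords u x) c b p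
      - YDiff D₁ D₂ (adaptedCoords u x) c a p * D₂.K (adaptedCoords u x) d b p) * h1

/-- `δR̄^0_{ba0}`. -/
theorem curv_zero_diff (hP : IsAdaptedPair D₁ D₂ u x U) (hp : p ∈ U) (a b : Fin (k + 1)) :
    D₁.curv (adaptedCoords u x) 0 b a 0 p = D₂.curv (adaptedCoords u x) 0 b a 0 p
      - pd I (adaptedCoords u x) a
          (fun q => D₂.lam u q * YDiff D₁ D₂ (adaptedCoords u x) 0 b q) p
      + pd I (adaptedCoords u x) 0
          (fun q => D₂.lam u q * YDiff D₁ D₂ (adaptedCoords u x) a b q) p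
      + (D₁.Γ (adaptedCoords u x) 0 a 0 p * D₁.Γ (adaptedCoords u x) 0 0 b p
        - D₁.Γ (adaptedCoords u x) 0 0 0 p * D₁.Γ (adaptedCoords u x) 0 a b p)
      - (D₂.Γ (adaptedCoords u x) 0 a 0 p * D₂.Γ (adaptedCoords u x) 0 0 b p
        - D₂.Γ (adaptedCoords u x) 0 0 0 p * D₂.Γ (adaptedCoords u x) 0 a b p)
      - D₂.lam u p * ∑ E : Fin k, (YDiff D₁ D₂ (adaptedCoords u x) a E.succ p
          * D₂.Γ (adaptedCoords u x) E.succ 0 b p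
        - YDiff D₁ D₂ (adaptedCoords u x) 0 E.succ p * D₂.Γ (adaptedCoords u x) E.succ a b p) := by
  have h1 : ∀ e a b, pd I (adaptedCoords u x) e (D₁.Γ (adaptedCoords u x) 0 a b) p
      = pd I (adaptedCoords u x) e (D₂.Γ (adaptedCoords u x) 0 a b) p
        - pd I (adaptedCoords u x) e
          (fun q => D₂.lam u q * YDiff D₁ D₂ (adaptedCoords u x) a b q) p := fun e a b => by
    rw [← hP.right.pd_sub hp (hP.right.Γ_smooth 0 a b)
      (hP.lam_mul_YDiff_smooth a b)]
    exact hP.right.pd_congr hp (fun q _ => hP.Γ_zero_diff a b q) e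
  -- The summands `e = E` are affine in `δY`, as one factor is common. The summand `e = 0` is
  -- quadratic and is kept unexpanded: it cancels when `b = 0` and simplifies when `δY(n,·) = 0`,
  -- the two cases used later.
  have h2 : ∑ E : Fin k, (D₁.Γ (adaptedCoords u x) 0 a E.succ p
        * D₁.Γ (adaptedCoords u x) E.succ 0 b p
        - D₁.Γ (adaptedCoords u x) 0 0 E.succ p * D₁.Γ (adaptedCoords u x) E.succ a b p)
      = ∑ E : Fin k, (D₂.Γ (adaptedCoords u x) 0 a E.succ p
        * D₂.Γ (adaptedCoords u x) E.succ 0 b p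
        - D₂.Γ (adaptedCoords u x) 0 0 E.succ p * D₂.Γ (adaptedCoords u x) E.succ a b p)
      - D₂.lam u p * ∑ E : Fin k, (YDiff D₁ D₂ (adaptedCoords u x) a E.succ p
          * D₂.Γ (adaptedCoords u x) E.succ 0 b p
        - YDiff D₁ D₂ (adaptedCoords u x) 0 E.succ p
          * D₂.Γ (adaptedCoords u x) E.succ a b p) := by
    rw [Finset.mul_sum, ← Finset.sum_sub_distrib]
    refine Finset.sum_congr rfl fun E _ => ?_
    rw [hP.Γ_succ_eq hp, hP.Γ_succ_eq hp, hP.Γ_zero_diff, hP.Γ_zero_diff]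
    ring
  rw [curv, curv, Fin.sum_univ_succ, Fin.sum_univ_succ, h2, h1, h1]
  ring

/-- The difference of `A_{ba0}`. -/
theorem lam_mul_tensorA_diff (hP : IsAdaptedPair D₁ D₂ u x U) (hp : p ∈ U)
    (a b : Fin (k + 1)) :
    D₂.lam u p * D₁.tensorA (adaptedCoords u x) b a 0 p
      = D₂.lam u p * D₂.tensorA (adaptedCoords u x) b a 0 p
      + (D₁.curv (adaptedCoords u x) 0 b a 0 p - D₂.curv (adaptedCoords u x) 0 b a 0 p)
      - D₂.lam u p * (∑ E, D₂.ℓSharp u x E p * D₂.K (adaptedCoords u x) a E.succ p)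
        * YDiff D₁ D₂ (adaptedCoords u x) 0 b p := by
  have h1 : ∑ F : Fin k, D₂.ℓc (adaptedCoords u x) F.succ p
        * D₁.curv (adaptedCoords u x) F.succ b a 0 p
      = ∑ F : Fin k, D₂.ℓc (adaptedCoords u x) F.succ p
        * D₂.curv (adaptedCoords u x) F.succ b a 0 p
      - (∑ E, D₂.ℓSharp u x E p * D₂.K (adaptedCoords u x) a E.succ p)
        * YDiff D₁ D₂ (adaptedCoords u x) 0 b p := by
    have h2 : ∀ F, D₂.ℓc (adaptedCoords u x) F.succ p
          * D₁.curv (adaptedCoords u x) F.succ b a 0 p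
        = D₂.ℓc (adaptedCoords u x) F.succ p * D₂.curv (adaptedCoords u x) F.succ b a 0 p
        - ∑ E, D₂.hInv u x E F p * D₂.ℓLeaf u x F p * D₂.K (adaptedCoords u x) a E.succ p
          * YDiff D₁ D₂ (adaptedCoords u x) 0 b p := by
      intro F
      rw [hP.curv_succ_diff hp, mul_sub, Finset.mul_sum]
      congr 1
      refine Finset.sum_congr rfl fun E _ => ?_
      rw [hP.right.K_zero hp, IsAdapted.hInv_symm D₂ u x F E, ℓLeaf]
      ring
    simp only [h2, Finset.sum_sub_distrib, ℓSharp, Finset.sum_mul]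
    rw [Finset.sum_comm]
  have h3 := hP.right.lam_mul_ℓc_zero hp
  rw [tensorA, tensorA, hP.ℓc_eq, Fin.sum_univ_succ, h1, Fin.sum_univ_succ, hP.K_eq, hP.ℓ₂_eq,
    hP.cov2_diff hp, hP.cov2_diff hp]
  simp only [hP.right.K_zero hp, hP.right.K_zero' hp]
  linear_combination (D₁.curv (adaptedCoords u x) 0 b a 0 p
    - D₂.curv (adaptedCoords u x) 0 b a 0 p) * h3

end IsAdaptedPair

/-- Relabelling of dummy indices for `lam_mul_pd_tr`. -/
theorem sum_swap_first_last {ι : Type*} [Fintype ι] (f : ι → ι → ι → ι → ℝ) :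
    ∑ a, ∑ b, ∑ c, ∑ e, f a b c e = ∑ e, ∑ b, ∑ c, ∑ a, f a b c e := by
  rw [Finset.sum_comm]
  refine Eq.trans ?_ Finset.sum_comm
  refine Finset.sum_congr rfl fun b _ => ?_
  rw [Finset.sum_comm]
  refine Eq.trans ?_ Finset.sum_comm
  exact Finset.sum_congr rfl fun c _ => Finset.sum_comm

/-- `A_{bcd}` is antisymmetric in its last two indices; this removes `A_{A00}` from `J_A`. -/
theorem tensorA_self (D : HypersurfaceData I H) (y : Fin (k + 1) → H → ℝ) (b c : Fin (k + 1))
    (p : H) : D.tensorA y b c c p = 0 := by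
  simp [tensorA, curv]

/-! ### Smoothness of the leaf quantities, derivatives along `n` and traces with `P`. -/

namespace IsAdapted

theorem tr_smooth (hA : D.IsAdapted u x U) {T : Fin k → Fin k → H → ℝ}
    (hT : ∀ A B, ContMDiffOn I 𝓘(ℝ, ℝ) ∞ (T A B) U) :
    ContMDiffOn I 𝓘(ℝ, ℝ) ∞ (D.tr u x T) U :=
  contMDiffOn_finsetSum fun A _ => contMDiffOn_finsetSum fun B _ =>
    (hA.hInv_smooth A B).mul (hT A B)

theorem χ_smooth (hA : D.IsAdapted u x U) (A B : Fin k) :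
    ContMDiffOn I 𝓘(ℝ, ℝ) ∞ (D.χ u x A B) U := hA.K_smooth A.succ B.succ

theorem χSharpℓ_smooth (hA : D.IsAdapted u x U) (A : Fin k) :
    ContMDiffOn I 𝓘(ℝ, ℝ) ∞ (D.χSharpℓ u x A) U :=
  contMDiffOn_finsetSum fun B _ => contMDiffOn_finsetSum fun C _ =>
    ((hA.hInv_smooth A B).mul (hA.χ_smooth B C)).mul (hA.ℓSharp_smooth C)

theorem ℓSharp₂_smooth (hA : D.IsAdapted u x U) :
    ContMDiffOn I 𝓘(ℝ, ℝ) ∞ (D.ℓSharp₂ u x) U :=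
  contMDiffOn_finsetSum fun A _ => contMDiffOn_finsetSum fun B _ =>
    ((hA.γc_smooth A.succ B.succ).mul (hA.ℓSharp_smooth A)).mul (hA.ℓSharp_smooth B)

theorem omega_smooth (hA : D.IsAdapted u x U) : ContMDiffOn I 𝓘(ℝ, ℝ) ∞ D.omega U := by
  refine ((contMDiffOn_const (c := (1 / 2 : ℝ))).mul
    ((hA.lam_smooth.pow 2).mul (hA.Yc_smooth 0 0))).congr fun p hp => ?_
  have := hA.two_mul_omega hp
  simp only [Pi.mul_apply]
  linear_combination 1 / 2 * this

theorem ΓLeaf_smooth (hA : D.IsAdapted u x U) (C A B : Fin k) :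
    ContMDiffOn I 𝓘(ℝ, ℝ) ∞ (D.ΓLeaf u x C A B) U :=
  contMDiffOn_const.mul (contMDiffOn_finsetSum fun E _ => (hA.hInv_smooth C E).mul
    (((hA.pd_smooth A.succ (hA.γc_smooth B.succ E.succ)).add
      (hA.pd_smooth B.succ (hA.γc_smooth A.succ E.succ))).sub
      (hA.pd_smooth E.succ (hA.γc_smooth A.succ B.succ))))

theorem boxLeaf_smooth (hA : D.IsAdapted u x U) {f : H → ℝ}
    (hf : ContMDiffOn I 𝓘(ℝ, ℝ) ∞ f U) : ContMDiffOn I 𝓘(ℝ, ℝ) ∞ (D.boxLeaf u x f) U :=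
  contMDiffOn_finsetSum fun A _ => contMDiffOn_finsetSum fun B _ =>
    (hA.hInv_smooth A B).mul ((hA.pd_smooth A.succ (hA.pd_smooth B.succ hf)).sub
      (contMDiffOn_finsetSum fun C _ => (hA.ΓLeaf_smooth C A B).mul (hA.pd_smooth C.succ hf)))

theorem divℓ_smooth (hA : D.IsAdapted u x U) : ContMDiffOn I 𝓘(ℝ, ℝ) ∞ (D.divℓ u x) U :=
  contMDiffOn_finsetSum fun A _ => contMDiffOn_finsetSum fun B _ =>
    (hA.hInv_smooth A B).mul ((hA.pd_smooth A.succ (hA.ℓc_smooth B.succ)).sub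
      (contMDiffOn_finsetSum fun C _ => (hA.ΓLeaf_smooth C A B).mul (hA.ℓc_smooth C.succ)))

theorem Pi'_smooth (hA : D.IsAdapted u x U) (a b : Fin (k + 1)) :
    ContMDiffOn I 𝓘(ℝ, ℝ) ∞ (D.Pi' (adaptedCoords u x) a b) U :=
  (hA.Yc_smooth a b).add (contMDiffOn_const.mul
    ((hA.pd_smooth a (hA.ℓc_smooth b)).sub (hA.pd_smooth b (hA.ℓc_smooth a))))

theorem lieℓ_smooth (hA : D.IsAdapted u x U) (A : Fin k) :
    ContMDiffOn I 𝓘(ℝ, ℝ) ∞ (D.lieℓ u x A) U := hA.lieN1_smooth hA.ℓc_smooth A.succ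

theorem gradLeaf_smooth (hA : D.IsAdapted u x U) {f : H → ℝ}
    (hf : ContMDiffOn I 𝓘(ℝ, ℝ) ∞ f U) (A : Fin k) :
    ContMDiffOn I 𝓘(ℝ, ℝ) ∞ (D.gradLeaf u x f A) U :=
  contMDiffOn_finsetSum fun B _ => (hA.hInv_smooth A B).mul (hA.pd_smooth B.succ hf)

theorem ΓA_smooth (hA : D.IsAdapted u x U) (A : Fin k) :
    ContMDiffOn I 𝓘(ℝ, ℝ) ∞ (D.ΓA u x A) U :=
  (((hA.boxLeaf_smooth (hA.smooth A)).add
    (((contMDiffOn_const.mul hA.omega_smooth).sub (hA.tr_smooth hA.χ_smooth)).mul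
      (contMDiffOn_finsetSum fun B _ =>
        (hA.ℓSharp_smooth B).mul (hA.pd_smooth B.succ (hA.smooth A))))).add
    (contMDiffOn_const.mul (contMDiffOn_finsetSum fun B _ =>
      (hA.χSharpℓ_smooth B).mul (hA.pd_smooth B.succ (hA.smooth A))))).sub
    (contMDiffOn_const.mul (contMDiffOn_finsetSum fun B _ =>
      ((hA.lieℓ_smooth B).add (contMDiffOn_finsetSum fun c _ =>
        (hA.Pi'_smooth B.succ c).mul (hA.nc_smooth c))).mul (hA.gradLeaf_smooth (hA.smooth A) B)))

theorem log_abs_lam_smooth (hA : D.IsAdapted u x U) :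
    ContMDiffOn I 𝓘(ℝ, ℝ) ∞ (fun q => Real.log |D.lam u q|) U := by
  simp only [Real.log_abs]
  intro p hp
  exact ((Real.contDiffAt_log.2 (hA.lam_ne_zero p)).contMDiffAt (n := ∞)).comp_contMDiffWithinAt
    p (hA.lam_smooth p hp)

theorem Φ_smooth (hA : D.IsAdapted u x U) : ContMDiffOn I 𝓘(ℝ, ℝ) ∞ (D.Φ u x) U :=
  (((((D.ℓ₂_smooth.contMDiffOn.sub hA.ℓSharp₂_smooth).mul
    (((contMDiffOn_const.mul hA.omega_smooth).sub (hA.tr_smooth hA.χ_smooth)).sub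
      (hA.nDeriv_smooth hA.log_abs_lam_smooth))).sub hA.divℓ_smooth).add
    (contMDiffOn_const.mul (contMDiffOn_finsetSum fun A _ =>
      (hA.lieℓ_smooth A).mul (hA.ℓSharp_smooth A)))).sub
    (contMDiffOn_const.mul (contMDiffOn_finsetSum fun A _ => contMDiffOn_finsetSum fun B _ =>
      ((hA.χ_smooth A B).mul (hA.ℓSharp_smooth A)).mul (hA.ℓSharp_smooth B)))).sub
    (hA.nDeriv_smooth D.ℓ₂_smooth.contMDiffOn)

/-- `Ω_A^B = χ_A^B`. -/
theorem Ω_eq (hA : D.IsAdapted u x U) (hp : p ∈ U) (A B : Fin k) :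
    D.Ω u x A B p = ∑ E, D.hInv u x B E p * D.χ u x A E p := by
  have h := hA.lam_mul_Γ_succ hp B A.succ
  rw [Ω, nablaN, hA.nc_succ hp, mul_zero, sub_zero, Fin.sum_univ_succ, Finset.sum_eq_zero
    (fun C _ => by rw [hA.nc_succ hp, zero_mul]), add_zero, nc_zero, Γ_symm]
  exact h

/-- With the index lowered, `Ω` is `χ`, so these two cancel in `𝓛_A` and only `tr_h χ` survives. -/
theorem sum_Ω_h (hA : D.IsAdapted u x U) (hp : p ∈ U) (A C : Fin k) :
    ∑ B, D.Ω u x A B p * D.h u x p B C = D.χ u x C A p := by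
  simp only [hA.Ω_eq hp, Finset.sum_mul]
  rw [Finset.sum_comm]
  have : ∀ E B, D.hInv u x B E p * D.χ u x A E p * D.h u x p B C
      = D.χ u x A E p * (D.hInv u x E B p * D.γc (adaptedCoords u x) B.succ C.succ p) := by
    intro E B
    rw [hInv_symm D u x B E, h, Matrix.of_apply]
    ring
  simp only [this, ← Finset.mul_sum, hA.sum_hInv_h hp]
  simp only [mul_ite, mul_one, mul_zero, Finset.sum_ite_eq', Finset.mem_univ, if_true]
  exact hA.K_symm hp _ _

/-- `𝓛_A = J_A - ½ n(h_{AB} Γ^B) - ½ tr_h χ h_{AC} Γ^C`. -/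
theorem combA_eq (hA : D.IsAdapted u x U) (hp : p ∈ U) (A : Fin k) :
    D.combA u x A p = D.J (adaptedCoords u x) A.succ p
      - 1 / 2 * (D.lam u p * pd I (adaptedCoords u x) 0
        (fun q => ∑ B, D.h u x q A B * D.ΓA u x B q) p)
      - 1 / 2 * D.tr u x (D.χ u x) p * ∑ B, D.h u x p A B * D.ΓA u x B p := by
  rw [combA, hA.nDeriv_eq hp]
  simp only [hA.sum_Ω_h hp, sub_self, zero_sub]
  have : ∑ C, -(D.tr u x (D.χ u x) p * D.h u x p A C) * D.ΓA u x C p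
      = -(D.tr u x (D.χ u x) p * ∑ B, D.h u x p A B * D.ΓA u x B p) := by
    rw [Finset.mul_sum, ← Finset.sum_neg_distrib]
    exact Finset.sum_congr rfl fun _ _ => by ring
  rw [this]
  ring

/-- `n(h^{AB}) = - 2 χ^{AB}`. -/
theorem lam_mul_pd_hInv (hA : D.IsAdapted u x U) (hp : p ∈ U) (A B : Fin k) :
    D.lam u p * pd I (adaptedCoords u x) 0 (D.hInv u x A B) p
      = -2 * ∑ C, ∑ E, D.hInv u x A C p * D.χ u x C E p * D.hInv u x E B p := by
  -- The relation `h⁻¹ h = 1` is differentiated along `n`, using `n(h) = 2χ`; `h7` then removes the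
  -- factor `h` on the right.
  have h1 : ∀ E : Fin k, ∑ C, D.γc (adaptedCoords u x) C.succ E.succ p
        * (D.lam u p * pd I (adaptedCoords u x) 0 (D.hInv u x A C) p)
      = -2 * ∑ C, D.hInv u x A C p * D.χ u x C E p := by
    intro E
    have h2 := hA.pd_sum hp Finset.univ (fun C =>
      (hA.hInv_smooth A C).mul (hA.γc_smooth C.succ E.succ)) 0
    have h3 : pd I (adaptedCoords u x) 0 (fun q => ∑ C, (D.hInv u x A C
        * D.γc (adaptedCoords u x) C.succ E.succ) q) p = 0 := by
      refine (hA.pd_congr hp (g := fun _ => if A = E then 1 else 0)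
        (fun q hq => hA.sum_hInv_h hq A E) 0).trans ?_
      rw [pd, differential_const]
      rfl
    rw [h3] at h2
    have h4 : ∀ C, pd I (adaptedCoords u x) 0 (D.hInv u x A C
        * D.γc (adaptedCoords u x) C.succ E.succ) p = _ := fun C =>
      hA.pd_mul hp (hA.hInv_smooth A C) (hA.γc_smooth C.succ E.succ) 0
    simp only [h4, Finset.sum_add_distrib] at h2
    have h5 : -2 * ∑ C, D.hInv u x A C p * D.χ u x C E p
        = -(D.lam u p * ∑ C, D.hInv u x A C p
          * pd I (adaptedCoords u x) 0 (D.γc (adaptedCoords u x) C.succ E.succ) p) := by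
      simp only [χ, hA.K_eq hp, Finset.mul_sum, ← Finset.sum_neg_distrib]
      exact Finset.sum_congr rfl fun _ _ => by ring
    have h6 : ∑ C, D.γc (adaptedCoords u x) C.succ E.succ p
        * (D.lam u p * pd I (adaptedCoords u x) 0 (D.hInv u x A C) p)
        = D.lam u p * ∑ C, D.γc (adaptedCoords u x) C.succ E.succ p
          * pd I (adaptedCoords u x) 0 (D.hInv u x A C) p := by
      rw [Finset.mul_sum]
      exact Finset.sum_congr rfl fun _ _ => by ring
    rw [h5, h6]
    linear_combination -D.lam u p * h2
  have h7 : ∑ E, (∑ C, D.γc (adaptedCoords u x) C.succ E.succ p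
        * (D.lam u p * pd I (adaptedCoords u x) 0 (D.hInv u x A C) p)) * D.hInv u x E B p
      = D.lam u p * pd I (adaptedCoords u x) 0 (D.hInv u x A B) p := by
    simp only [Finset.sum_mul]
    rw [Finset.sum_comm]
    have : ∀ C E, D.γc (adaptedCoords u x) C.succ E.succ p
        * (D.lam u p * pd I (adaptedCoords u x) 0 (D.hInv u x A C) p) * D.hInv u x E B p
        = (D.lam u p * pd I (adaptedCoords u x) 0 (D.hInv u x A C) p)
          * (D.γc (adaptedCoords u x) C.succ E.succ p * D.hInv u x E B p) := fun C E => by ring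
    simp only [this, ← Finset.mul_sum, hA.sum_h_hInv hp]
    simp
  rw [← h7]
  simp only [h1, Finset.mul_sum, Finset.sum_mul]
  rw [Finset.sum_comm]
  exact Finset.sum_congr rfl fun _ _ => Finset.sum_congr rfl fun _ _ => by ring

/-- `n(tr_h T) = tr_h (n(T)) - 2 χ^{AB} T_{AB}`. -/
theorem lam_mul_pd_tr (hA : D.IsAdapted u x U) (hp : p ∈ U) {T : Fin k → Fin k → H → ℝ}
    (hT : ∀ A B, ContMDiffOn I 𝓘(ℝ, ℝ) ∞ (T A B) U) :
    D.lam u p * pd I (adaptedCoords u x) 0 (D.tr u x T) p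
      = D.lam u p * ∑ A, ∑ B, D.hInv u x A B p * pd I (adaptedCoords u x) 0 (T A B) p
        - 2 * ∑ A, ∑ B, D.hInv u x A B p
          * ∑ C, ∑ E, D.hInv u x C E p * D.χ u x A C p * T E B p := by
  have hs : ∀ A B, ContMDiffOn I 𝓘(ℝ, ℝ) ∞ (fun q => D.hInv u x A B q * T A B q) U :=
    fun A B => (hA.hInv_smooth A B).mul (hT A B)
  have h1 : pd I (adaptedCoords u x) 0 (D.tr u x T) p
      = ∑ A, ∑ B, (D.hInv u x A B p * pd I (adaptedCoords u x) 0 (T A B) p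
        + T A B p * pd I (adaptedCoords u x) 0 (D.hInv u x A B) p) := by
    unfold tr
    rw [hA.pd_sum hp _ fun A => contMDiffOn_finsetSum fun B _ => hs A B]
    refine Finset.sum_congr rfl fun A _ => ?_
    rw [hA.pd_sum hp _ fun B => hs A B]
    exact Finset.sum_congr rfl fun B _ => hA.pd_mul hp (hA.hInv_smooth A B) (hT A B) 0
  have h2 : D.lam u p * ∑ A, ∑ B, T A B p * pd I (adaptedCoords u x) 0 (D.hInv u x A B) p
      = -2 * ∑ A, ∑ B, D.hInv u x A B p
          * ∑ C, ∑ E, D.hInv u x C E p * D.χ u x A C p * T E B p := by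
    have h3 : ∀ A B, D.lam u p * (T A B p * pd I (adaptedCoords u x) 0 (D.hInv u x A B) p)
        = -2 * ∑ C, ∑ E, D.hInv u x A C p * D.χ u x C E p * D.hInv u x E B p * T A B p := by
      intro A B
      have := hA.lam_mul_pd_hInv hp A B
      simp only [← Finset.sum_mul]
      linear_combination T A B p * this
    simp only [Finset.mul_sum] at h3 ⊢
    simp only [h3]
    rw [sum_swap_first_last]
    refine Finset.sum_congr rfl fun A _ => Finset.sum_congr rfl fun B _ =>
      Finset.sum_congr rfl fun C _ => Finset.sum_congr rfl fun E _ => ?_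
    rw [hInv_symm D u x E C, show D.χ u x C A p = D.χ u x A C p from hA.K_symm hp _ _]
    ring
  simp only [h1, Finset.sum_add_distrib, mul_add, h2]
  ring

/-- The trace with `P` of a tensor annihilated by `n` is its trace with `h`. -/
theorem sum_Pc_of_zero (hA : D.IsAdapted u x U) (hp : p ∈ U) {T : Fin (k + 1) → Fin (k + 1) → ℝ}
    (h0 : ∀ a, T 0 a = 0) (h0' : ∀ a, T a 0 = 0) :
    ∑ a, ∑ b, D.Pc (adaptedCoords u x) a b p * T a b
      = ∑ A : Fin k, ∑ B : Fin k, D.hInv u x A B p * T A.succ B.succ := by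
  simp [Fin.sum_univ_succ, h0, h0', hA.Pc_succ_succ hp]

theorem J_eq (hA : D.IsAdapted u x U) (hp : p ∈ U) (b : Fin (k + 1)) :
    D.J (adaptedCoords u x) b p = D.lam u p * D.Ric (adaptedCoords u x) 0 b p := by
  rw [J, Fin.sum_univ_succ, Finset.sum_eq_zero (fun C _ => by rw [hA.nc_succ hp, mul_zero]),
    nc_zero]
  ring

theorem Ric_eq (hA : D.IsAdapted u x U) (hp : p ∈ U) (a b : Fin (k + 1)) :
    D.Ric (adaptedCoords u x) a b p
      = ∑ c, ∑ d, D.Pc (adaptedCoords u x) c d p * D.tensorB (adaptedCoords u x) a c b d p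
        - D.lam u p * D.tensorA (adaptedCoords u x) b a 0 p
        - D.lam u p * D.tensorA (adaptedCoords u x) a b 0 p := by
  have h1 : ∑ c, (D.tensorA (adaptedCoords u x) b a c p + D.tensorA (adaptedCoords u x) a b c p)
      * D.nc (adaptedCoords u x) c p
      = (D.tensorA (adaptedCoords u x) b a 0 p + D.tensorA (adaptedCoords u x) a b 0 p)
      * D.lam u p := by
    rw [Fin.sum_univ_succ, Finset.sum_eq_zero (fun C _ => by rw [hA.nc_succ hp, mul_zero]),
      nc_zero, add_zero]
  rw [Ric, h1]
  simp only [mul_comm (D.tensorB _ _ _ _ _ _)]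
  ring

end IsAdapted

/-! ### First statement: change of `J_A` and of `Γ^A_H`. -/

namespace IsAdaptedPair

theorem J_diff (hP : IsAdaptedPair D₁ D₂ u x U) (hp : p ∈ U) (A : Fin k) :
    D₁.J (adaptedCoords u x) A.succ p = D₂.J (adaptedCoords u x) A.succ p
      - D₂.lam u p * pd I (adaptedCoords u x) 0
          (fun q => D₂.lam u q * YDiff D₁ D₂ (adaptedCoords u x) A.succ 0 q) p
      - D₂.lam u p * D₂.tr u x (D₂.χ u x) p * YDiff D₁ D₂ (adaptedCoords u x) A.succ 0 p := by
  have hA := hP.right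
  have hZ := hP.YDiff_zero_zero hp
  have hB : ∑ c, ∑ d, D₂.Pc (adaptedCoords u x) c d p
        * D₁.tensorB (adaptedCoords u x) 0 c A.succ d p
      = ∑ c, ∑ d, D₂.Pc (adaptedCoords u x) c d p
        * D₂.tensorB (adaptedCoords u x) 0 c A.succ d p
      + (∑ C : Fin k, ∑ E : Fin k, D₂.hInv u x C E p * (YDiff D₁ D₂ (adaptedCoords u x) E.succ 0 p
          * D₂.χ u x A C p))
      - D₂.tr u x (D₂.χ u x) p * YDiff D₁ D₂ (adaptedCoords u x) A.succ 0 p := by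
    have h1 := hA.sum_Pc_of_zero hp (T := fun c d => YDiff D₁ D₂ (adaptedCoords u x) d 0 p
          * D₂.K (adaptedCoords u x) A.succ c p) (by simp [hA.K_zero' hp]) (by simp [hZ])
    have h2 := hA.sum_Pc_of_zero hp (T := fun c d => D₂.K (adaptedCoords u x) d c p)
      (by simp [hA.K_zero' hp]) (by simp [hA.K_zero hp])
    have h3 : D₂.tr u x (D₂.χ u x) p
        = ∑ c, ∑ d, D₂.Pc (adaptedCoords u x) c d p * D₂.K (adaptedCoords u x) d c p := by
      rw [h2, tr]
      simp only [χ]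
      exact Finset.sum_congr rfl fun C _ => Finset.sum_congr rfl fun E _ => by
        rw [hA.K_symm hp]
    rw [h3]
    change _ = _ + ∑ C : Fin k, ∑ E : Fin k, D₂.hInv u x C E p
      * (YDiff D₁ D₂ (adaptedCoords u x) E.succ 0 p
        * D₂.K (adaptedCoords u x) A.succ C.succ p) - _
    rw [← h1]
    simp only [hP.tensorB_diff hp, hA.K_zero hp, Finset.sum_mul, ← Finset.sum_add_distrib,
      ← Finset.sum_sub_distrib]
    exact Finset.sum_congr rfl fun c _ => Finset.sum_congr rfl fun d _ => by ring
  have hA1 := hP.lam_mul_tensorA_diff hp A.succ 0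
  rw [hP.curv_zero_diff hp, hP.right.pd_eq_zero hp (f := fun q => D₂.lam u q
    * YDiff D₁ D₂ (adaptedCoords u x) 0 0 q)
    (fun q hq => by rw [hP.YDiff_zero_zero hq, mul_zero])] at hA1
  simp only [hA.Γ_succ_zero_zero hp, hZ] at hA1
  -- This contraction of `χ` with `δY(n,·)`, coming from `A_{0A0}`, cancels the one produced by `B`
  -- in `hB`.
  have h4 : D₂.lam u p * ∑ E : Fin k, (YDiff D₁ D₂ (adaptedCoords u x) A.succ E.succ p * 0
        - YDiff D₁ D₂ (adaptedCoords u x) 0 E.succ p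
          * D₂.Γ (adaptedCoords u x) E.succ A.succ 0 p)
      = -∑ C : Fin k, ∑ E : Fin k, D₂.hInv u x C E p * (YDiff D₁ D₂ (adaptedCoords u x) E.succ 0 p
          * D₂.χ u x A C p) := by
    rw [Finset.mul_sum, Finset.sum_comm, ← Finset.sum_neg_distrib]
    refine Finset.sum_congr rfl fun E _ => ?_
    have h5 := hA.lam_mul_Γ_succ hp E A.succ
    have h6 : ∑ C : Fin k, D₂.hInv u x C E p * (YDiff D₁ D₂ (adaptedCoords u x) E.succ 0 p
          * D₂.χ u x A C p) = YDiff D₁ D₂ (adaptedCoords u x) E.succ 0 p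
          * ∑ C, D₂.hInv u x E C p * D₂.K (adaptedCoords u x) A.succ C.succ p := by
      rw [Finset.mul_sum]
      refine Finset.sum_congr rfl fun C _ => ?_
      rw [IsAdapted.hInv_symm D₂ u x C E, χ]
      ring
    rw [h6, ← h5, YDiff_symm D₁ D₂ _ 0]
    ring
  rw [h4] at hA1
  rw [hP.left.J_eq hp, hA.J_eq hp, hP.left.Ric_eq hp, hA.Ric_eq hp, hP.lam_eq, hP.Pc_eq, hB,
    tensorA_self, tensorA_self]
  linear_combination -D₂.lam u p * hA1

/-- Once `ω` is fixed, `Y` enters only through `Π(·, n)`, and `F` is common to both data sets; the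
factor `h^{AB}` is the gradient of `x^A`. -/
theorem ΓA_diff (hP : IsAdaptedPair D₁ D₂ u x U) (hp : p ∈ U) (A : Fin k) :
    D₁.ΓA u x A p = D₂.ΓA u x A p - 2 * ∑ B, D₂.hInv u x A B p
      * (D₂.lam u p * YDiff D₁ D₂ (adaptedCoords u x) B.succ 0 p) := by
  have hPi : ∀ B : Fin k, ∑ c, D₁.Pi' (adaptedCoords u x) B.succ c p * D₂.nc (adaptedCoords u x) c p
      = ∑ c, D₂.Pi' (adaptedCoords u x) B.succ c p * D₂.nc (adaptedCoords u x) c p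
        + D₂.lam u p * YDiff D₁ D₂ (adaptedCoords u x) B.succ 0 p := by
    intro B
    rw [Fin.sum_univ_succ, Fin.sum_univ_succ]
    simp only [hP.right.nc_succ hp, mul_zero, Finset.sum_const_zero, IsAdapted.nc_zero, Pi', YDiff,
      hP.F_eq]
    ring
  have hgrad : ∀ B, D₂.gradLeaf u x (x A) B p = D₂.hInv u x A B p := by
    intro B
    simp only [gradLeaf, hP.right.pd_x hp]
    simp [IsAdapted.hInv_symm D₂ u x B A]
  have h1 : ∑ B, (D₂.lieℓ u x B p + (∑ c, D₂.Pi' (adaptedCoords u x) B.succ c p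
        * D₂.nc (adaptedCoords u x) c p + D₂.lam u p * YDiff D₁ D₂ (adaptedCoords u x) B.succ 0 p))
        * D₂.hInv u x A B p
      = ∑ B, (D₂.lieℓ u x B p + ∑ c, D₂.Pi' (adaptedCoords u x) B.succ c p
        * D₂.nc (adaptedCoords u x) c p) * D₂.hInv u x A B p
      + ∑ B, D₂.hInv u x A B p
        * (D₂.lam u p * YDiff D₁ D₂ (adaptedCoords u x) B.succ 0 p) := by
    rw [← Finset.sum_add_distrib]
    exact Finset.sum_congr rfl fun _ _ => by ring
  unfold ΓA
  rw [hP.boxLeaf_eq, hP.omega_eq p hp, hP.tr_eq, hP.χ_eq, hP.ℓSharp_eq, hP.χSharpℓ_eq, hP.lieℓ_eq,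
    hP.nc_eq, hP.gradLeaf_eq]
  simp only [hgrad, hPi]
  rw [h1]
  ring

theorem sum_h_ΓA_diff (hP : IsAdaptedPair D₁ D₂ u x U) (hp : p ∈ U) (A : Fin k) :
    ∑ B, D₁.h u x p A B * D₁.ΓA u x B p = ∑ B, D₂.h u x p A B * D₂.ΓA u x B p
      - 2 * (D₂.lam u p * YDiff D₁ D₂ (adaptedCoords u x) A.succ 0 p) := by
  have h1 : ∑ B, D₂.h u x p A B * (2 * ∑ C, D₂.hInv u x B C p
      * (D₂.lam u p * YDiff D₁ D₂ (adaptedCoords u x) C.succ 0 p))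
      = 2 * (D₂.lam u p * YDiff D₁ D₂ (adaptedCoords u x) A.succ 0 p) := by
    simp only [Finset.mul_sum]
    rw [Finset.sum_comm]
    have : ∀ C B, D₂.h u x p A B * (2 * (D₂.hInv u x B C p
        * (D₂.lam u p * YDiff D₁ D₂ (adaptedCoords u x) C.succ 0 p)))
        = (D₂.γc (adaptedCoords u x) A.succ B.succ p * D₂.hInv u x B C p)
        * (2 * (D₂.lam u p * YDiff D₁ D₂ (adaptedCoords u x) C.succ 0 p)) := fun C B => by
      rw [h, Matrix.of_apply]
      ring
    simp only [this, ← Finset.sum_mul, hP.right.sum_h_hInv hp]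
    simp
  simp only [hP.ΓA_diff hp, hP.h_eq, mul_sub, Finset.sum_sub_distrib]
  rw [h1]

/-- With `z_A = λ δY_{A0}`, the change `-n(z_A) - tr_h χ z_A` of `J_A` is offset by `-½ n(-2 z_A) -
½ tr_h χ (-2 z_A)`. -/
theorem combA_eq (hP : IsAdaptedPair D₁ D₂ u x U) (hp : p ∈ U) (A : Fin k) :
    D₁.combA u x A p = D₂.combA u x A p := by
  have hs : ContMDiffOn I 𝓘(ℝ, ℝ) ∞ (fun q => ∑ B, D₂.h u x q A B * D₂.ΓA u x B q) U :=
    contMDiffOn_finsetSum fun B _ =>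
      (hP.right.γc_smooth A.succ B.succ).mul (hP.right.ΓA_smooth B)
  have hs' : ContMDiffOn I 𝓘(ℝ, ℝ) ∞
      (fun q => D₂.lam u q * YDiff D₁ D₂ (adaptedCoords u x) A.succ 0 q) U :=
    hP.lam_mul_YDiff_smooth A.succ 0
  have hs2 : ContMDiffOn I 𝓘(ℝ, ℝ) ∞ (fun q => 2 * (D₂.lam u q
      * YDiff D₁ D₂ (adaptedCoords u x) A.succ 0 q)) U := contMDiffOn_const.mul hs'
  have hd : pd I (adaptedCoords u x) 0 (fun q => ∑ B, D₁.h u x q A B * D₁.ΓA u x B q) p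
      = pd I (adaptedCoords u x) 0 (fun q => ∑ B, D₂.h u x q A B * D₂.ΓA u x B q) p
      - 2 * pd I (adaptedCoords u x) 0
        (fun q => D₂.lam u q * YDiff D₁ D₂ (adaptedCoords u x) A.succ 0 q) p := by
    rw [← hP.right.pd_const_mul hp 2 hs',
      ← hP.right.pd_sub hp hs hs2]
    exact hP.right.pd_congr hp (fun q hq => hP.sum_h_ΓA_diff hq A) 0
  rw [hP.left.combA_eq hp, hP.right.combA_eq hp, hd, hP.sum_h_ΓA_diff hp, hP.J_diff hp, hP.lam_eq,
    hP.tr_eq, hP.χ_eq]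
  ring

end IsAdaptedPair

/-! ### Second statement: change of `H` and of `Γ^{u̲}_H`. -/

namespace IsAdapted

theorem inv_lam_mul_Γu (hA : D.IsAdapted u x U) (p : H) :
    (D.lam u p)⁻¹ * D.Γu u x p = D.tr u x (D.Υ u x) p + D.Φ u x p := by
  rw [Γu, ← mul_add, inv_mul_cancel_left₀ (hA.lam_ne_zero p)]

end IsAdapted

namespace IsAdaptedPair

/-- The only term of `τ` containing `Y` is `Π(n,·)`, so equal `τ` gives `λ δY_{0A} = 0`; the
component `00` is controlled by `ω`. -/
theorem YDiff_zero_of_τ_eq (hP : IsAdaptedPair D₁ D₂ u x U)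
    (hτ : ∀ p ∈ U, ∀ A, D₁.τ u x A p = D₂.τ u x A p) (hp : p ∈ U) (a : Fin (k + 1)) :
    YDiff D₁ D₂ (adaptedCoords u x) 0 a p = 0 := by
  refine Fin.cases (hP.YDiff_zero_zero hp) (fun A => ?_) a
  have h1 := hτ p hp A
  unfold τ η at h1
  rw [hP.lieN1_eq, hP.ℓPar_eq, hP.nc_eq, hP.ℓSharp_eq, hP.χ_eq, hP.lam_eq, Fin.sum_univ_succ,
    Fin.sum_univ_succ] at h1
  simp only [hP.right.nc_succ hp, zero_mul, Finset.sum_const_zero, IsAdapted.nc_zero, Pi',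
    hP.F_eq] at h1
  have h2 : D₂.lam u p * YDiff D₁ D₂ (adaptedCoords u x) 0 A.succ p = 0 := by
    rw [YDiff]
    linear_combination h1
  exact (mul_eq_zero.1 h2).resolve_left (hP.right.lam_ne_zero p)

/-- The difference of `ℛ_{ab}` when `δY(n, ·) = 0`. -/
theorem Ric_diff (hP : IsAdaptedPair D₁ D₂ u x U)
    (hZ : ∀ p ∈ U, ∀ a, YDiff D₁ D₂ (adaptedCoords u x) 0 a p = 0) (hp : p ∈ U)
    (a b : Fin (k + 1)) :
    D₁.Ric (adaptedCoords u x) a b p = D₂.Ric (adaptedCoords u x) a b p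
      - D₂.K (adaptedCoords u x) a b p * D₂.tr u x
        (fun A B => YDiff D₁ D₂ (adaptedCoords u x) A.succ B.succ) p
      - YDiff D₁ D₂ (adaptedCoords u x) a b p * D₂.tr u x (D₂.χ u x) p
      + 2 * (∑ C : Fin k, ∑ E : Fin k, D₂.hInv u x C E p * (D₂.K (adaptedCoords u x) a C.succ p
        * YDiff D₁ D₂ (adaptedCoords u x) E.succ b p))
      + 2 * (∑ C : Fin k, ∑ E : Fin k, D₂.hInv u x C E p * (D₂.K (adaptedCoords u x) b C.succ p
        * YDiff D₁ D₂ (adaptedCoords u x) E.succ a p))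
      - 2 * (D₂.lam u p * pd I (adaptedCoords u x) 0 (YDiff D₁ D₂ (adaptedCoords u x) a b) p)
      + 4 * D₂.omega p * YDiff D₁ D₂ (adaptedCoords u x) a b p := by
  have hA := hP.right
  have hZ' : ∀ a, YDiff D₁ D₂ (adaptedCoords u x) a 0 p = 0 := fun a => by
    rw [YDiff_symm, hZ p hp]
  have hB : ∑ c, ∑ d, D₂.Pc (adaptedCoords u x) c d p
        * D₁.tensorB (adaptedCoords u x) a c b d p
      = ∑ c, ∑ d, D₂.Pc (adaptedCoords u x) c d p
        * D₂.tensorB (adaptedCoords u x) a c b d p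
      - D₂.K (adaptedCoords u x) a b p * D₂.tr u x
        (fun A B => YDiff D₁ D₂ (adaptedCoords u x) A.succ B.succ) p
      - YDiff D₁ D₂ (adaptedCoords u x) a b p * D₂.tr u x (D₂.χ u x) p
      + (∑ C : Fin k, ∑ E : Fin k, D₂.hInv u x C E p * (D₂.K (adaptedCoords u x) a C.succ p
        * YDiff D₁ D₂ (adaptedCoords u x) E.succ b p))
      + (∑ C : Fin k, ∑ E : Fin k, D₂.hInv u x C E p * (D₂.K (adaptedCoords u x) b C.succ p
        * YDiff D₁ D₂ (adaptedCoords u x) E.succ a p)) := by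
    have h1 := hA.sum_Pc_of_zero hp (T := fun c d => YDiff D₁ D₂ (adaptedCoords u x) c d p)
      (hZ p hp) hZ'
    have h2 := hA.sum_Pc_of_zero hp (T := fun c d => D₂.K (adaptedCoords u x) c d p)
      (hA.K_zero hp) (hA.K_zero' hp)
    have h3 := hA.sum_Pc_of_zero hp (T := fun c d => D₂.K (adaptedCoords u x) a d p
        * YDiff D₁ D₂ (adaptedCoords u x) c b p) (by simp [hZ p hp]) (by simp [hA.K_zero' hp])
    have h4 := hA.sum_Pc_of_zero hp (T := fun c d => D₂.K (adaptedCoords u x) b c p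
        * YDiff D₁ D₂ (adaptedCoords u x) d a p) (by simp [hA.K_zero' hp]) (by simp [hZ p hp])
    have h5 : ∑ C : Fin k, ∑ E : Fin k, D₂.hInv u x C E p * (D₂.K (adaptedCoords u x) a C.succ p
        * YDiff D₁ D₂ (adaptedCoords u x) E.succ b p)
        = ∑ C : Fin k, ∑ E : Fin k, D₂.hInv u x C E p * (D₂.K (adaptedCoords u x) a E.succ p
        * YDiff D₁ D₂ (adaptedCoords u x) C.succ b p) := by
      rw [Finset.sum_comm]
      exact Finset.sum_congr rfl fun C _ => Finset.sum_congr rfl fun E _ => by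
        rw [IsAdapted.hInv_symm D₂ u x E C]
    rw [h5]
    unfold tr χ
    rw [← h1, ← h2, ← h3, ← h4]
    simp only [hP.tensorB_diff hp, Finset.mul_sum, ← Finset.sum_add_distrib,
      ← Finset.sum_sub_distrib]
    refine Finset.sum_congr rfl fun c _ => Finset.sum_congr rfl fun d _ => ?_
    rw [YDiff_symm D₁ D₂ _ d c, hA.K_symm hp d c, YDiff_symm D₁ D₂ _ b c, YDiff_symm D₁ D₂ _ b a]
    ring
  have hT : ∀ a b, D₂.lam u p * D₁.tensorA (adaptedCoords u x) b a 0 p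
      = D₂.lam u p * D₂.tensorA (adaptedCoords u x) b a 0 p
      + D₂.lam u p * pd I (adaptedCoords u x) 0 (YDiff D₁ D₂ (adaptedCoords u x) a b) p
      - 2 * D₂.omega p * YDiff D₁ D₂ (adaptedCoords u x) a b p
      - ∑ C : Fin k, ∑ E : Fin k, D₂.hInv u x C E p * (D₂.K (adaptedCoords u x) b C.succ p
        * YDiff D₁ D₂ (adaptedCoords u x) E.succ a p) := by
    intro a b
    have h1 := hP.lam_mul_tensorA_diff hp a b
    rw [hP.curv_zero_diff hp, hA.pd_eq_zero hp (f := fun q => D₂.lam u q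
      * YDiff D₁ D₂ (adaptedCoords u x) 0 b q) (fun q hq => by rw [hZ q hq, mul_zero]),
      hA.pd_mul hp hA.lam_smooth (hP.YDiff_smooth a b)] at h1
    simp only [hP.Γ_zero_diff, hZ p hp, hZ'] at h1
    have h2 : D₂.lam u p * ∑ E : Fin k, (YDiff D₁ D₂ (adaptedCoords u x) a E.succ p
          * D₂.Γ (adaptedCoords u x) E.succ 0 b p
          - 0 * D₂.Γ (adaptedCoords u x) E.succ a b p)
        = ∑ C : Fin k, ∑ E : Fin k, D₂.hInv u x C E p * (D₂.K (adaptedCoords u x) b C.succ p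
        * YDiff D₁ D₂ (adaptedCoords u x) E.succ a p) := by
      rw [Finset.mul_sum, Finset.sum_comm]
      refine Finset.sum_congr rfl fun E _ => ?_
      have h3 := hA.lam_mul_Γ_succ hp E b
      have h4 : ∑ C : Fin k, D₂.hInv u x C E p * (D₂.K (adaptedCoords u x) b C.succ p
          * YDiff D₁ D₂ (adaptedCoords u x) E.succ a p)
          = (∑ C, D₂.hInv u x E C p * D₂.K (adaptedCoords u x) b C.succ p)
            * YDiff D₁ D₂ (adaptedCoords u x) E.succ a p := by
        rw [Finset.sum_mul]
        refine Finset.sum_congr rfl fun C _ => ?_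
        rw [IsAdapted.hInv_symm D₂ u x C E]
        ring
      rw [h4, ← h3, YDiff_symm D₁ D₂ _ a, IsAdapted.Γ_symm D₂ _ E.succ 0 b]
      ring
    rw [h2] at h1
    -- The product rule for `∂_0(λ δY_{ab})` leaves `∂_0 λ δY_{ab}`, and the term `λ Γ̄^0_{00}
    -- δY_{ab}` equals `(-∂_0 λ - 2ω) δY_{ab}`; only `-2ω δY_{ab}` remains.
    linear_combination h1 + YDiff D₁ D₂ (adaptedCoords u x) a b p * hA.lam_mul_Γ_zero hp
  rw [hP.left.Ric_eq hp, hA.Ric_eq hp, hP.lam_eq, hP.Pc_eq, hB, hT a b, hT b a,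
    YDiff_symm D₁ D₂ _ b a]
  ring

/-- Every term of `Ric_diff` is annihilated by `n`, so tracing with `P` is tracing with `h`. The two
traces of `S`, equal to the contraction of `χ` with `δY`, combine with `h^{AB} n(δY_{AB})` into
`n(t)`; the remaining terms give `-2 tr_h χ t + 4ω t`, and the factor `-½` finishes. -/
theorem Hc_diff (hP : IsAdaptedPair D₁ D₂ u x U)
    (hZ : ∀ p ∈ U, ∀ a, YDiff D₁ D₂ (adaptedCoords u x) 0 a p = 0) (hp : p ∈ U) :
    D₁.Hc (adaptedCoords u x) p = D₂.Hc (adaptedCoords u x) p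
      + D₂.lam u p * pd I (adaptedCoords u x) 0 (D₂.tr u x
        (fun A B => YDiff D₁ D₂ (adaptedCoords u x) A.succ B.succ)) p
      + (D₂.tr u x (D₂.χ u x) p - 2 * D₂.omega p) * D₂.tr u x
        (fun A B => YDiff D₁ D₂ (adaptedCoords u x) A.succ B.succ) p := by
  have hA := hP.right
  have hZ' : ∀ q ∈ U, ∀ a, YDiff D₁ D₂ (adaptedCoords u x) a 0 q = 0 := fun q hq a => by
    rw [YDiff_symm, hZ q hq]
  set t := D₂.tr u x (fun A B => YDiff D₁ D₂ (adaptedCoords u x) A.succ B.succ) p with ht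
  set θ := D₂.tr u x (D₂.χ u x) p with hθ
  set S : Fin (k + 1) → Fin (k + 1) → ℝ := fun a b =>
    ∑ C : Fin k, ∑ E : Fin k, D₂.hInv u x C E p * (D₂.K (adaptedCoords u x) a C.succ p
        * YDiff D₁ D₂ (adaptedCoords u x) E.succ b p) with hS
  have h1 := hA.sum_Pc_of_zero hp (T := fun c d => YDiff D₁ D₂ (adaptedCoords u x) c d p)
      (hZ p hp) (hZ' p hp)
  have h2 := hA.sum_Pc_of_zero hp (T := fun c d => D₂.K (adaptedCoords u x) c d p)
      (hA.K_zero hp) (hA.K_zero' hp)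
  have h3 := hA.sum_Pc_of_zero hp (T := S) (by simp [S, hA.K_zero hp])
    (by simp [S, hZ' p hp])
  have h4 := hA.sum_Pc_of_zero hp (T := fun a b => S b a) (by simp [S, hZ' p hp])
    (by simp [S, hA.K_zero hp])
  have h5 := hA.sum_Pc_of_zero hp (T := fun a b =>
      pd I (adaptedCoords u x) 0 (YDiff D₁ D₂ (adaptedCoords u x) a b) p)
    (fun a => hA.pd_eq_zero hp (fun q hq => hZ q hq a) 0)
    (fun a => hA.pd_eq_zero hp (fun q hq => hZ' q hq a) 0)
  -- `S` itself need not be symmetric, but its trace does not depend on the order of its indices.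
  have h6 : ∑ A : Fin k, ∑ B : Fin k, D₂.hInv u x A B p * S B.succ A.succ
      = ∑ A : Fin k, ∑ B : Fin k, D₂.hInv u x A B p * S A.succ B.succ := by
    rw [Finset.sum_comm]
    exact Finset.sum_congr rfl fun C _ => Finset.sum_congr rfl fun E _ => by
        rw [IsAdapted.hInv_symm D₂ u x E C]
  have h7 := hA.lam_mul_pd_tr hp
    (T := fun A B => YDiff D₁ D₂ (adaptedCoords u x) A.succ B.succ)
    (fun A B => hP.YDiff_smooth A.succ B.succ)
  have h8 : ∑ A : Fin k, ∑ B : Fin k, D₂.hInv u x A B p * ∑ C, ∑ E, D₂.hInv u x C E p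
        * D₂.χ u x A C p * YDiff D₁ D₂ (adaptedCoords u x) E.succ B.succ p
      = ∑ A : Fin k, ∑ B : Fin k, D₂.hInv u x A B p * S A.succ B.succ := by
    simp only [S, χ, mul_assoc]
  rw [h8] at h7
  have h9 : ∑ a, ∑ b, D₂.Pc (adaptedCoords u x) a b p * D₁.Ric (adaptedCoords u x) a b p
      = ∑ a, ∑ b, D₂.Pc (adaptedCoords u x) a b p * D₂.Ric (adaptedCoords u x) a b p
      - t * (∑ a, ∑ b, D₂.Pc (adaptedCoords u x) a b p * D₂.K (adaptedCoords u x) a b p)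
      + (4 * D₂.omega p - θ) * (∑ a, ∑ b, D₂.Pc (adaptedCoords u x) a b p
        * YDiff D₁ D₂ (adaptedCoords u x) a b p)
      + 2 * (∑ a, ∑ b, D₂.Pc (adaptedCoords u x) a b p * S a b)
      + 2 * (∑ a, ∑ b, D₂.Pc (adaptedCoords u x) a b p * S b a)
      - 2 * D₂.lam u p * (∑ a, ∑ b, D₂.Pc (adaptedCoords u x) a b p
        * pd I (adaptedCoords u x) 0 (YDiff D₁ D₂ (adaptedCoords u x) a b) p) := by
    simp only [Finset.mul_sum, ← Finset.sum_add_distrib, ← Finset.sum_sub_distrib]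
    refine Finset.sum_congr rfl fun a _ => Finset.sum_congr rfl fun b _ => ?_
    rw [hP.Ric_diff hZ hp]
    ring
  rw [h1, h2, h3, h4, h5, h6] at h9
  change _ = _ - t * θ + (4 * D₂.omega p - θ) * t + _ + _ - _ at h9
  rw [Hc, Hc, hP.Pc_eq, h9, h7]
  ring

/-- The function `Φ` involves only metric data and `ω`, so `λ⁻¹ Γ^{u̲}_H` changes by `t = tr_h δY`
alone, which is exactly what `Hc_diff` compensates. -/
theorem comb_eq (hP : IsAdaptedPair D₁ D₂ u x U)
    (hτ : ∀ p ∈ U, ∀ A, D₁.τ u x A p = D₂.τ u x A p) (hp : p ∈ U) :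
    D₁.comb u x p = D₂.comb u x p := by
  have hA := hP.right
  have hu : ∀ q ∈ U, (D₁.lam u q)⁻¹ * D₁.Γu u x q = (D₂.lam u q)⁻¹ * D₂.Γu u x q
      + D₂.tr u x (fun A B => YDiff D₁ D₂ (adaptedCoords u x) A.succ B.succ) q := by
    intro q hq
    have h1 : D₂.tr u x (fun A B => YDiff D₁ D₂ (adaptedCoords u x) A.succ B.succ) q
        = D₂.tr u x (D₁.Υ u x) q - D₂.tr u x (D₂.Υ u x) q := by
      simp only [tr, Υ, YDiff, mul_sub, Finset.sum_sub_distrib]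
    rw [hP.left.inv_lam_mul_Γu, hA.inv_lam_mul_Γu, hP.Φ_eq hq, hP.tr_eq, h1]
    ring
  have hs : ContMDiffOn I 𝓘(ℝ, ℝ) ∞ (fun q => (D₂.lam u q)⁻¹ * D₂.Γu u x q) U :=
    ((hA.tr_smooth fun A B => hA.Yc_smooth A.succ B.succ).add hA.Φ_smooth).congr
      fun q _ => hA.inv_lam_mul_Γu q
  have hd := hA.pd_congr hp hu 0
  rw [hA.pd_add hp hs (hA.tr_smooth fun A B => hP.YDiff_smooth A.succ B.succ)] at hd
  rw [comb, comb, hP.left.nDeriv_eq hp, hA.nDeriv_eq hp, hd,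
    hP.Hc_diff (fun q hq => hP.YDiff_zero_of_τ_eq hτ hq) hp, hP.omega_eq p hp]
  have hu' := hu p hp
  rw [hP.lam_eq] at hu' ⊢
  rw [hP.tr_eq, hP.χ_eq]
  linear_combination -(D₂.tr u x (D₂.χ u x) p - 2 * D₂.omega p) * hu'

end IsAdaptedPair

end HypersurfaceData

theorem mainTheorem6 {k : ℕ} {M : Type*} [TopologicalSpace M]
    (I : ModelWithCorners ℝ (EuclideanSpace ℝ (Fin (k + 1))) M)
    (H : Type*) [TopologicalSpace H] [ChartedSpace M H] [IsManifold I ∞ H]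
    (D₁ D₂ : HypersurfaceData I H)
    (hmet : D₁.toMetricHypersurfaceData = D₂.toMetricHypersurfaceData)
    (hchar : D₁.IsCharacteristic)
    (u : H → ℝ) (hu : D₁.IsFoliationFunction u)
    (U : Set H) (hU : IsOpen U)
    (x : Fin k → H → ℝ) (hx : ∀ A, ContMDiffOn I 𝓘(ℝ, ℝ) ∞ (x A) U)
    (hxind : ∀ p ∈ U, LinearIndependent ℝ (fun A => differential I (x A) p))
    (hxn : ∀ p ∈ U, ∀ A, D₁.nDeriv (x A) p = 0)
    (hω : ∀ p ∈ U, D₁.omega p = D₂.omega p) :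
    (∀ p ∈ U, ∀ A, D₁.combA u x A p = D₂.combA u x A p) ∧
    ((∀ p ∈ U, ∀ A, D₁.τ u x A p = D₂.τ u x A p) →
      ∀ p ∈ U, D₁.comb u x p = D₂.comb u x p) := by
  have hchar₂ : D₂.IsCharacteristic := hmet ▸ hchar
  have hu₂ : D₂.IsFoliationFunction u := hmet ▸ hu
  have hxn₂ : ∀ p ∈ U, ∀ A, D₂.nDeriv (x A) p = 0 := hmet ▸ hxn
  have hP : HypersurfaceData.IsAdaptedPair D₁ D₂ u x U :=
    ⟨⟨hchar, hu, hU, hx, hxind, hxn⟩, ⟨hchar₂, hu₂, hU, hx, hxind, hxn₂⟩, hmet, hω⟩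
  exact ⟨fun p hp A => hP.combA_eq hp A, fun hτ p hp => hP.comb_eq hτ hp⟩
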